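/- For integers $d\ge 1$, $k\ge 1$ let $B_{\mathrm{sum}}=\{y\in\mathbb R^d:\sum_i|y_i|\le k,\ \max_i|y_i|\le 1\}$. For $j\ge 1$ let the slice $R_j=\{x\in(0,1)^d: j-1<\sum_i x_i\le j\}$. A permutation $\sigma$ of $\{1,\dots,d\}$ has an ascent at $i<d$ if $\sigma(i)<\sigma(i+1)$; let $S_{d,j}$ be the set of permutations with exactly $j$ ascents and $A_{d,j}=|S_{d,j}|$ the Eulerian number. Let $\Delta_d=\{x\in(0,1)^d:x_1<\dots<x_d\}$ be the fundamental simplex, $\sigma(x)=(x_{\sigma(1)},\dots,x_{\sigma(d)})$, and let Stanley's map be $\varphi(x)_i=x_{i-1}-x_i+\mathbf 1[x_{i-1}<x_i]$ with $x_0=0$. Computation model: a program is a fixed finite text of an imperative language (assignment, sequencing, branching, while loops) whose memory has natural-number cells and real cells with indirect addressing. Each of the following costs one step: addition, subtraction or multiplication of reals; addition or truncated subtraction of natural numbers; conversion of a natural number to a real; use of a natural-number constant; a comparison or Boolean operation; a memory access; a draw of an independent uniform random real from $[0,1]$; a control step. The number of steps thus bounds the number of arithmetic operations. Theorem. (1)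 For all $d,j\ge1$, the Lebesgue measure of the slice is $|R_j|=A_{d,j-1}/d!$. (2) There are one program $P$ and one constant $C$ such that for all $d,k\ge1$, on input $(d,k)$, $P$ halts after at most $C d^2$ steps for every outcome of its random draws, and its output is distributed uniformly on $B_{\mathrm{sum}}$. Moreover $P$ also leaves in memory the random choices $(j,\sigma,x,s)$ from which its output $y$ arises, and the joint law of $(j,\sigma,x,s,y)$ is the following: $j\in\{1,\dots,k\}$ is chosen with probability $|R_j|/\sum_{i=1}^k|R_i|$; given $j$, the permutation $\sigma$ is uniform on $S_{d,j-1}$, the point $x$ is uniform on $\Delta_d$ and $s$ is uniform on $\{-1,1\}^d$, all independent; and $y_i=s_i\,\varphi(\sigma(x))_i$ for all $i$. -/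

import Mathlib

open MeasureTheory ProbabilityTheory
open scoped ENNReal Nat

noncomputable section

namespace SumBall

/-! ### The Sum ball, its slices, Eulerian numbers and Stanley's map -/

/-- The `d`-dimensional `ℓ₁` ball of radius `r` around the origin. -/
def l1Ball (d : ℕ) (r : ℝ) : Set (Fin d → ℝ) := {y | ∑ i, |y i| ≤ r}

/-- The `d`-dimensional `ℓ_∞` unit ball around the origin. -/
def linfBall (d : ℕ) : Set (Fin d → ℝ) := {y | ∀ i, |y i| ≤ 1}

/-- The Sum norm ball. -/
def sumBall (d k : ℕ) : Set (Fin d → ℝ) := l1Ball d k ∩ linfBall d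

/-- The part `I_j` of the open cube `(0,1)^d` where the coordinate sum is at most `j`. -/
def cubeBelow (d j : ℕ) : Set (Fin d → ℝ) :=
  {x | (∀ i, x i ∈ Set.Ioo (0 : ℝ) 1) ∧ ∑ i, x i ≤ (j : ℝ)}

/-- The slice `R_j = I_j \ I_{j-1}` of the open cube (used for `1 ≤ j`). -/
def slice (d j : ℕ) : Set (Fin d → ℝ) := cubeBelow d j \ cubeBelow d (j - 1)

/-- The number of ascents of a finite sequence: the number of positions `i` with
`f i < f (i + 1)`. -/
def ascents {d : ℕ} {α : Type*} [LinearOrder α] (f : Fin d → α) : ℕ :=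
  Set.ncard {i : Fin d | ∃ h : (i : ℕ) + 1 < d, f i < f ⟨(i : ℕ) + 1, h⟩}

/-- `S_{d,j}`: the permutations of `d` elements with exactly `j` ascents. -/
def permsWithAscents (d j : ℕ) : Set (Equiv.Perm (Fin d)) := {σ | ascents (σ : Fin d → Fin d) = j}

/-- The Eulerian number `A_{d,j}`. -/
def eulerian (d j : ℕ) : ℕ := (permsWithAscents d j).ncard

/-- The fundamental simplex: points of the open cube with increasing coordinates. -/
def fundamentalSimplex (d : ℕ) : Set (Fin d → ℝ) :=
  {x | (∀ i, x i ∈ Set.Ioo (0 : ℝ) 1) ∧ StrictMono x}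

/-- The coordinate `x_{i-1}` that precedes position `i`, where the coordinate before the first
one is `0` by convention. -/
def prevCoord {d : ℕ} (x : Fin d → ℝ) (i : Fin d) : ℝ :=
  if (i : ℕ) = 0 then 0 else x ⟨(i : ℕ) - 1, lt_of_le_of_lt (Nat.sub_le _ _) i.isLt⟩

/-- Stanley's map `φ(x)_i = x_{i-1} - x_i + 1[x_{i-1} < x_i]`. -/
def stanley {d : ℕ} (x : Fin d → ℝ) : Fin d → ℝ := fun i =>
  open scoped Classical in
  prevCoord x i - x i + if prevCoord x i < x i then 1 else 0

/-- The sign vectors `{-1, 1}^d`. -/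
def signVectors (d : ℕ) : Set (Fin d → ℝ) := {s | ∀ i, s i = -1 ∨ s i = 1}

/-- The discrete `σ`-algebra on permutations. -/
instance permMeasurableSpace (d : ℕ) : MeasurableSpace (Equiv.Perm (Fin d)) := ⊤

/-- What the sampling method produces on the way to its output: the index of the chosen slice, the
chosen permutation (as the list of its values, the `d` elements being `0, …, d - 1`), the point of
the fundamental simplex, the signs, and finally the output point. -/
abbrev Transcript (d : ℕ) : Type :=
  ℕ × (Fin d → ℕ) × (Fin d → ℝ) × (Fin d → ℝ) × (Fin d → ℝ)

/-- The transcript that results from the random choices `j`, `σ`, `x`, `s`: the output point is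
`s · φ(σ(x))`, where `σ(x) = (x_{σ(1)}, …, x_{σ(d)})`. -/
def mkTranscript {d : ℕ} (j : ℕ) (c : Equiv.Perm (Fin d) × (Fin d → ℝ) × (Fin d → ℝ)) :
    Transcript d :=
  (j, fun i => (c.1 i : ℕ), c.2.1, c.2.2, fun i => c.2.2 i * stanley (fun l => c.2.1 (c.1 l)) i)

/-- The law of the transcript of the sampling method: choose the slice index `j ∈ {1, …, k}` with
probability proportional to the volume of `R_j`; given `j`, choose independently a uniform
permutation with `j - 1` ascents, a uniform point of the fundamental simplex, and uniform signs. -/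
def transcriptLaw (d k : ℕ) : Measure (Transcript d) :=
  ∑ j ∈ Finset.Icc 1 k,
    (volume (slice d j) / ∑ i ∈ Finset.Icc 1 k, volume (slice d i)) •
      ((uniformOn (permsWithAscents d (j - 1))).prod
        ((cond volume (fundamentalSimplex d)).prod (uniformOn (signVectors d)))).map
          (mkTranscript j)

/-! ### A randomized real-number machine with a step count

Programs are finite texts of a small imperative language, so that one program serves all inputs.
The memory has integer cells and real cells, both addressed by pairs of natural numbers. The only
operations are addition, subtraction and multiplication of reals, addition and truncated
subtraction of natural numbers, conversion of a natural number to a real, comparisons, reading and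
writing of (indirectly addressed) cells, drawing a uniform random real from `[0,1]`, and control
flow. There is no division, no rounding, and no real constant other than natural numbers.
Every single operation and every control step costs one unit. -/

/-- The memory of the machine, with the number of random reals drawn so far. -/
structure Memory where
  int : ℕ → ℕ → ℕ
  real : ℕ → ℕ → ℝ
  drawn : ℕ

namespace Memory

/-- Write `v` to the integer cell `(a, b)`. -/
def writeInt (m : Memory) (a b v : ℕ) : Memory :=
  { m with int := fun a' b' => if a' = a ∧ b' = b then v else m.int a' b' }

/-- Write `v` to the real cell `(a, b)`. -/
def writeReal (m : Memory) (a b : ℕ) (v : ℝ) : Memory :=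
  { m with real := fun a' b' => if a' = a ∧ b' = b then v else m.real a' b' }

/-- Memory at the start: all cells hold zero, except for the inputs `d` and `k` in the integer cells
`(0, 0)` and `(0, 1)`. -/
def init (d k : ℕ) : Memory :=
  ((⟨fun _ _ => 0, fun _ _ => 0, 0⟩ : Memory).writeInt 0 0 d).writeInt 0 1 k

/-- The output point, read from the first `d` real cells of row `0`. -/
def output (d : ℕ) (m : Memory) : Fin d → ℝ := fun i => m.real 0 i

/-- The transcript: slice index in the integer cell `(1, 0)`, permutation in integer row `2`, point
of the fundamental simplex in real row `1`, signs in real row `2`, output in real row `0`. -/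
def transcript (d : ℕ) (m : Memory) : Transcript d :=
  (m.int 1 0, fun i => m.int 2 i, fun i => m.real 1 i, fun i => m.real 2 i, m.output d)

end Memory

/-- Integer expressions. -/
inductive IExpr where
  | const (n : ℕ)
  | get (a b : IExpr)
  | add (e f : IExpr)
  | sub (e f : IExpr)

/-- Real expressions. -/
inductive RExpr where
  | ofInt (e : IExpr)
  | get (a b : IExpr)
  | add (e f : RExpr)
  | sub (e f : RExpr)
  | mul (e f : RExpr)

/-- Tests. -/
inductive Test where
  | intLt (e f : IExpr)
  | intEq (e f : IExpr)
  | realLt (e f : RExpr)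
  | realEq (e f : RExpr)
  | not (p : Test)
  | and (p q : Test)

/-- Programs. The first two arguments of the three assignments are the address of the cell that is
written; `draw` writes a fresh random real to it. -/
inductive Program where
  | skip
  | setInt (a b e : IExpr)
  | setReal (a b : IExpr) (e : RExpr)
  | draw (a b : IExpr)
  | seq (c c' : Program)
  | ite (p : Test) (c c' : Program)
  | while (p : Test) (c : Program)

/-- Value of an integer expression. -/
def IExpr.eval (m : Memory) : IExpr → ℕ
  | .const n => n
  | .get a b => m.int (a.eval m) (b.eval m)
  | .add e f => e.eval m + f.eval m
  | .sub e f => e.eval m - f.eval m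

/-- Number of operations in an integer expression. -/
def IExpr.cost : IExpr → ℕ
  | .const _ => 1
  | .get a b => 1 + a.cost + b.cost
  | .add e f => 1 + e.cost + f.cost
  | .sub e f => 1 + e.cost + f.cost

/-- Value of a real expression. -/
def RExpr.eval (m : Memory) : RExpr → ℝ
  | .ofInt e => (e.eval m : ℝ)
  | .get a b => m.real (a.eval m) (b.eval m)
  | .add e f => e.eval m + f.eval m
  | .sub e f => e.eval m - f.eval m
  | .mul e f => e.eval m * f.eval m

/-- Number of operations in a real expression. -/
def RExpr.cost : RExpr → ℕ
  | .ofInt e => 1 + e.cost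
  | .get a b => 1 + a.cost + b.cost
  | .add e f => 1 + e.cost + f.cost
  | .sub e f => 1 + e.cost + f.cost
  | .mul e f => 1 + e.cost + f.cost

/-- Truth of a test. -/
def Test.holds (m : Memory) : Test → Prop
  | .intLt e f => e.eval m < f.eval m
  | .intEq e f => e.eval m = f.eval m
  | .realLt e f => e.eval m < f.eval m
  | .realEq e f => e.eval m = f.eval m
  | .not p => ¬ p.holds m
  | .and p q => p.holds m ∧ q.holds m

/-- Number of operations in a test. -/
def Test.cost : Test → ℕ
  | .intLt e f => 1 + e.cost + f.cost
  | .intEq e f => 1 + e.cost + f.cost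
  | .realLt e f => 1 + e.cost + f.cost
  | .realEq e f => 1 + e.cost + f.cost
  | .not p => 1 + p.cost
  | .and p q => 1 + p.cost + q.cost

/-- `Runs ω c m t m'`: with the sequence `ω` as its supply of random reals, the program `c` started
in memory `m` halts after exactly `t` steps in memory `m'`. -/
inductive Runs (ω : ℕ → unitInterval) : Program → Memory → ℕ → Memory → Prop
  | skip (m : Memory) : Runs ω .skip m 1 m
  | setInt (a b e : IExpr) (m : Memory) :
      Runs ω (.setInt a b e) m (1 + a.cost + b.cost + e.cost)
        (m.writeInt (a.eval m) (b.eval m) (e.eval m))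
  | setReal (a b : IExpr) (e : RExpr) (m : Memory) :
      Runs ω (.setReal a b e) m (1 + a.cost + b.cost + e.cost)
        (m.writeReal (a.eval m) (b.eval m) (e.eval m))
  | draw (a b : IExpr) (m : Memory) :
      Runs ω (.draw a b) m (1 + a.cost + b.cost)
        { m.writeReal (a.eval m) (b.eval m) (ω m.drawn : ℝ) with drawn := m.drawn + 1 }
  | seq {c c' : Program} {m m' m'' : Memory} {t t' : ℕ} :
      Runs ω c m t m' → Runs ω c' m' t' m'' → Runs ω (.seq c c') m (1 + t + t') m''
  | iteTrue {p : Test} {c c' : Program} {m m' : Memory} {t : ℕ} :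
      p.holds m → Runs ω c m t m' → Runs ω (.ite p c c') m (1 + p.cost + t) m'
  | iteFalse {p : Test} {c c' : Program} {m m' : Memory} {t : ℕ} :
      ¬ p.holds m → Runs ω c' m t m' → Runs ω (.ite p c c') m (1 + p.cost + t) m'
  | whileTrue {p : Test} {c : Program} {m m' m'' : Memory} {t t' : ℕ} :
      p.holds m → Runs ω c m t m' → Runs ω (.while p c) m' t' m'' →
      Runs ω (.while p c) m (1 + p.cost + t + t') m''
  | whileFalse {p : Test} {c : Program} {m : Memory} :
      ¬ p.holds m → Runs ω (.while p c) m (1 + p.cost) m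

/-- The machine is deterministic once the random reals are fixed. -/
theorem Runs.deterministic {ω : ℕ → unitInterval} {c : Program} {m m₁ m₂ : Memory} {t₁ t₂ : ℕ}
    (h₁ : Runs ω c m t₁ m₁) (h₂ : Runs ω c m t₂ m₂) : t₁ = t₂ ∧ m₁ = m₂ := by
  induction h₁ generalizing t₂ m₂ with
  | skip m => cases h₂; exact ⟨rfl, rfl⟩
  | setInt a b e m => cases h₂; exact ⟨rfl, rfl⟩
  | setReal a b e m => cases h₂; exact ⟨rfl, rfl⟩
  | draw a b m => cases h₂; exact ⟨rfl, rfl⟩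
  | seq _ _ ih ih' =>
    cases h₂ with
    | seq k k' =>
      obtain ⟨rfl, rfl⟩ := ih k
      obtain ⟨rfl, rfl⟩ := ih' k'
      exact ⟨rfl, rfl⟩
  | iteTrue hp _ ih =>
    cases h₂ with
    | iteTrue _ k => obtain ⟨rfl, rfl⟩ := ih k; exact ⟨rfl, rfl⟩
    | iteFalse hn _ => exact absurd hp hn
  | iteFalse hp _ ih =>
    cases h₂ with
    | iteTrue hn _ => exact absurd hn hp
    | iteFalse _ k => obtain ⟨rfl, rfl⟩ := ih k; exact ⟨rfl, rfl⟩
  | whileTrue hp _ _ ih ih' =>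
    cases h₂ with
    | whileTrue _ k k' =>
      obtain ⟨rfl, rfl⟩ := ih k
      obtain ⟨rfl, rfl⟩ := ih' k'
      exact ⟨rfl, rfl⟩
    | whileFalse hn => exact absurd hp hn
  | whileFalse hp =>
    cases h₂ with
    | whileTrue hn _ _ => exact absurd hn hp
    | whileFalse _ => exact ⟨rfl, rfl⟩

/-- The law of a supply of independent uniform random reals from `[0,1]`. -/
def randomSupply : Measure (ℕ → unitInterval) := Measure.infinitePi fun _ => (volume : Measure unitInterval)

end SumBall

end

open SumBall

/-! Volumes. Modulo 1, Stanley's map is the torus endomorphism that sends `t` to the differences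
`t_{i-1} - t_i`. It is continuous and surjective, hence preserves Haar measure, and therefore
Stanley's map preserves Lebesgue measure on the cube (`measurePreserving_stanley`). The coordinates
of the image telescope to `ascents x + 1 - x_d` (`sum_stanley`), so up to a null set the preimage of
`R_j` consists of the points with `j - 1` ascents. These form `A_{d,j-1}` of the `d!` simplices of
equal volume into which the order of the coordinates cuts the cube (`volume_slice`).

Uniformity. In the prescribed law the Eulerian numbers and factorials cancel: `σ` is uniform among
all permutations with fewer than `k` ascents (`transcriptLaw_apply`). Then `σ(x)` is uniform among
the points of the cube with fewer than `k` ascents, Stanley's map carries it to the part of the cube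
with sum at most `k`, and the `2^d` reflections of that part tile the ball almost everywhere
(`map_output_transcriptLaw`).

Sampling `σ`. A permutation of `n` elements with `a` ascents has `a + 1` gaps where inserting a new
maximum keeps the number of ascents, and `n - a` gaps where it adds one. This gives the Eulerian
recursion, tabulated in quadratic time. The sampler chooses the final count, walks down the table
deciding at each size which term of the recursion is used, then walks up, inserting each maximum
into a uniform gap of the required kind. If there are `g` such gaps, a prescribed step has
probability `g R(n,J) / R(n+1,J')` times `1 / g`, where `R` is `runNumber`; the product telescopes
(`exists_box_word`, `exists_box`).

Law of the program. Each admissible permutation gets a box of draws that forces it. The boxes are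
disjoint and their volumes add up to one, so they account for almost every outcome
(`map_transcript`). The simplex point and the signs use draws at other fixed positions, whence
independence. Halting and step bounds hold for every outcome. -/

noncomputable section

namespace SumBall

/-! ### Time-bounded total correctness of programs -/

/-- Program `c`, started in memory `m`, halts within `T` steps in a memory that satisfies `Q`. -/
def Reaches (ω : ℕ → unitInterval) (c : Program) (T : ℕ) (Q : Memory → Prop) (m : Memory) : Prop :=
  ∃ t ≤ T, ∃ m', Runs ω c m t m' ∧ Q m'

theorem Reaches.mono {ω : ℕ → unitInterval} {c : Program} {T T' : ℕ} {Q Q' : Memory → Prop}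
    {m : Memory} (h : Reaches ω c T Q m) (hT : T ≤ T') (hQ : ∀ m', Q m' → Q' m') :
    Reaches ω c T' Q' m := by
  obtain ⟨t, ht, m', hr, hq⟩ := h
  exact ⟨t, ht.trans hT, m', hr, hQ _ hq⟩

theorem Reaches.le {ω : ℕ → unitInterval} {c : Program} {T T' : ℕ} {Q : Memory → Prop}
    {m : Memory} (h : Reaches ω c T Q m) (hT : T ≤ T') : Reaches ω c T' Q m :=
  h.mono hT fun _ => id

theorem Reaches.seq {ω : ℕ → unitInterval} {c c' : Program} {T T' : ℕ} {Q Q' : Memory → Prop}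
    {m : Memory} (h : Reaches ω c T Q' m) (h' : ∀ m', Q' m' → Reaches ω c' T' Q m') :
    Reaches ω (.seq c c') (1 + T + T') Q m := by
  obtain ⟨t, ht, m', hr, hq⟩ := h
  obtain ⟨t', ht', m'', hr', hq'⟩ := h' m' hq
  exact ⟨1 + t + t', by omega, m'', .seq hr hr', hq'⟩

/-- Programs without loops. -/
def Program.LoopFree : Program → Prop
  | .skip | .setInt _ _ _ | .setReal _ _ _ | .draw _ _ => True
  | .seq c c' | .ite _ c c' => c.LoopFree ∧ c'.LoopFree
  | .while _ _ => False

/-- A bound for the number of steps of a program without loops. -/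
def Program.maxCost : Program → ℕ
  | .skip => 1
  | .setInt a b e => 1 + a.cost + b.cost + e.cost
  | .setReal a b e => 1 + a.cost + b.cost + e.cost
  | .draw a b => 1 + a.cost + b.cost
  | .seq c c' => 1 + c.maxCost + c'.maxCost
  | .ite p c c' => 1 + p.cost + (c.maxCost + c'.maxCost)
  | .while _ _ => 0

/-- The effect of drawing a random real into the cell `(a, b)`. -/
def Memory.drawReal (ω : ℕ → unitInterval) (m : Memory) (a b : ℕ) : Memory :=
  { m.writeReal a b (ω m.drawn : ℝ) with drawn := m.drawn + 1 }

open scoped Classical in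
/-- The memory in which a program without loops halts. -/
def Program.exec (ω : ℕ → unitInterval) : Program → Memory → Memory
  | .skip, m => m
  | .setInt a b e, m => m.writeInt (a.eval m) (b.eval m) (e.eval m)
  | .setReal a b e, m => m.writeReal (a.eval m) (b.eval m) (e.eval m)
  | .draw a b, m => m.drawReal ω (a.eval m) (b.eval m)
  | .seq c c', m => c'.exec ω (c.exec ω m)
  | .ite p c c', m => if p.holds m then c.exec ω m else c'.exec ω m
  | .while _ _, m => m

theorem Program.LoopFree.exists_runs {ω : ℕ → unitInterval} {c : Program} (h : c.LoopFree)
    (m : Memory) : ∃ t ≤ c.maxCost, Runs ω c m t (c.exec ω m) := by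
  induction c generalizing m with
  | skip => exact ⟨_, le_rfl, .skip m⟩
  | setInt a b e => exact ⟨_, le_rfl, .setInt a b e m⟩
  | setReal a b e => exact ⟨_, le_rfl, .setReal a b e m⟩
  | draw a b => exact ⟨_, le_rfl, .draw a b m⟩
  | seq c c' ih ih' =>
    obtain ⟨t, ht, hr⟩ := ih h.1 m
    obtain ⟨t', ht', hr'⟩ := ih' h.2 (c.exec ω m)
    exact ⟨1 + t + t', by simp only [maxCost]; omega, .seq hr hr'⟩
  | ite p c c' ih ih' =>
    by_cases hp : p.holds m
    · obtain ⟨t, ht, hr⟩ := ih h.1 m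
      refine ⟨1 + p.cost + t, by simp only [maxCost]; omega, ?_⟩
      simp only [exec, if_pos hp]
      exact .iteTrue hp hr
    · obtain ⟨t, ht, hr⟩ := ih' h.2 m
      refine ⟨1 + p.cost + t, by simp only [maxCost]; omega, ?_⟩
      simp only [exec, if_neg hp]
      exact .iteFalse hp hr
  | _ => exact h.elim

/-- Loop-free code has a computable cost bound and an explicit final memory, so its step bound is a
numerical check and its correctness a simplification. -/
theorem Reaches.of_loopFree {ω : ℕ → unitInterval} {c : Program} {T : ℕ} {m : Memory}
    {Q : Memory → Prop} (h : c.LoopFree) (hT : c.maxCost ≤ T) (hQ : Q (c.exec ω m)) :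
    Reaches ω c T Q m := by
  obtain ⟨t, ht, hr⟩ := h.exists_runs (ω := ω) m
  exact ⟨t, ht.trans hT, _, hr, hQ⟩

/-! ### Notation for expressions, and the invariant rule for counting loops. -/

instance (n : ℕ) : OfNat IExpr n := ⟨.const n⟩
instance : Add IExpr := ⟨.add⟩
instance : Sub IExpr := ⟨.sub⟩
instance : Add RExpr := ⟨.add⟩
instance : Sub RExpr := ⟨.sub⟩
instance : Mul RExpr := ⟨.mul⟩
instance : Coe IExpr RExpr := ⟨.ofInt⟩

@[simp] theorem IExpr.eval_ofNat (m : Memory) (n : ℕ) : IExpr.eval m (OfNat.ofNat n) = n := rfl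
@[simp] theorem IExpr.eval_add (m : Memory) (e f : IExpr) : (e + f).eval m = e.eval m + f.eval m :=
  rfl
@[simp] theorem IExpr.eval_sub (m : Memory) (e f : IExpr) : (e - f).eval m = e.eval m - f.eval m :=
  rfl
@[simp] theorem RExpr.eval_add (m : Memory) (e f : RExpr) : (e + f).eval m = e.eval m + f.eval m :=
  rfl
@[simp] theorem RExpr.eval_sub (m : Memory) (e f : RExpr) : (e - f).eval m = e.eval m - f.eval m :=
  rfl
@[simp] theorem RExpr.eval_mul (m : Memory) (e f : RExpr) : (e * f).eval m = e.eval m * f.eval m :=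
  rfl

/-- The integer cell `(a, e)`. -/
def iat (a : ℕ) (e : IExpr) : IExpr := .get (.const a) e

/-- The integer cell `(a, 0)`. -/
def ivar (a : ℕ) : IExpr := iat a (.const 0)

/-- The real cell `(a, e)`. -/
def rat (a : ℕ) (e : IExpr) : RExpr := .get (.const a) e

/-- Loop over `i = 0, …, n - 1`, where `i` is kept in the integer cell `(v, 0)`. -/
def forLoop (v : ℕ) (n : IExpr) (c : Program) : Program :=
  .seq (.setInt (.const v) (.const 0) (.const 0))
    (.while (.intLt (ivar v) n)
      (.seq c (.setInt (.const v) (.const 0) (.add (ivar v) (.const 1)))))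

/-- The loop bound is re-evaluated at every test, so the invariant must fix its value. Test,
sequencing and increment cost `n.cost + 14` beside the body; the last test costs `n.cost + 5` and
the initialization 5. -/
theorem Reaches.forLoop {ω : ℕ → unitInterval} {v : ℕ} {n : IExpr} {c : Program} {T N : ℕ}
    {m : Memory} (Inv : ℕ → Memory → Prop) (h0 : Inv 0 (m.writeInt v 0 0))
    (hv : ∀ i m, Inv i m → m.int v 0 = i) (hn : ∀ i m, Inv i m → n.eval m = N)
    (hc : ∀ i m, i < N → Inv i m →
      Reaches ω c T (fun m' => m'.int v 0 = i ∧ Inv (i + 1) (m'.writeInt v 0 (i + 1))) m) :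
    Reaches ω (SumBall.forLoop v n c) (N * (T + n.cost + 14) + n.cost + 10) (Inv N) m := by
  have key : ∀ r i m, i + r = N → Inv i m →
      Reaches ω (.while (.intLt (ivar v) n)
        (.seq c (.setInt (.const v) (.const 0) (.add (ivar v) (.const 1)))))
        (r * (T + n.cost + 14) + n.cost + 5) (Inv N) m := by
    intro r
    induction r with
    | zero =>
      intro i m hi hI
      refine ⟨_, ?_, m, .whileFalse ?_, ?_⟩
      · simp [Test.cost, ivar, iat, IExpr.cost]; omega
      · have h1 := hn i m hI
        have h2 := hv i m hI
        simp only [Test.holds, ivar, iat, IExpr.eval]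
        omega
      · obtain rfl : i = N := by omega
        exact hI
    | succ r ih =>
      intro i m hi hI
      obtain ⟨t, ht, m', hr, hv', hI'⟩ := hc i m (by omega) hI
      obtain ⟨t', ht', m'', hr', hI''⟩ := ih (i + 1) _ (by omega) hI'
      refine ⟨_, ?_, m'', .whileTrue ?_ (.seq hr (.setInt _ _ _ m')) (t' := t') ?_, hI''⟩
      · simp only [Test.cost, ivar, iat, IExpr.cost]
        have : (r + 1) * (T + n.cost + 14) = r * (T + n.cost + 14) + (T + n.cost + 14) := by ring
        omega
      · have h1 := hn i m hI
        have h2 := hv i m hI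
        simp only [Test.holds, ivar, iat, IExpr.eval]
        omega
      · simpa only [ivar, iat, IExpr.eval, hv'] using hr'
  obtain ⟨t, ht, m', hr, hI⟩ := key N 0 _ (by omega) h0
  refine ⟨_, ?_, m', .seq (.setInt _ _ _ m) (t' := t) ?_, hI⟩
  · simp only [IExpr.cost]; omega
  · simpa only [IExpr.eval] using hr

namespace Memory

@[simp] theorem int_writeInt (m : Memory) (a b v a' b' : ℕ) :
    (m.writeInt a b v).int a' b' = if a' = a ∧ b' = b then v else m.int a' b' := rfl
@[simp] theorem real_writeInt (m : Memory) (a b v : ℕ) : (m.writeInt a b v).real = m.real := rfl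
@[simp] theorem drawn_writeInt (m : Memory) (a b v : ℕ) : (m.writeInt a b v).drawn = m.drawn := rfl
@[simp] theorem int_writeReal (m : Memory) (a b : ℕ) (v : ℝ) : (m.writeReal a b v).int = m.int := rfl
@[simp] theorem real_writeReal (m : Memory) (a b : ℕ) (v : ℝ) (a' b' : ℕ) :
    (m.writeReal a b v).real a' b' = if a' = a ∧ b' = b then v else m.real a' b' := rfl
@[simp] theorem drawn_writeReal (m : Memory) (a b : ℕ) (v : ℝ) :
    (m.writeReal a b v).drawn = m.drawn := rfl
@[simp] theorem int_drawReal (ω : ℕ → unitInterval) (m : Memory) (a b : ℕ) :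
    (m.drawReal ω a b).int = m.int := rfl
@[simp] theorem real_drawReal (ω : ℕ → unitInterval) (m : Memory) (a b a' b' : ℕ) :
    (m.drawReal ω a b).real a' b' =
      if a' = a ∧ b' = b then (ω m.drawn : ℝ) else m.real a' b' := rfl
@[simp] theorem drawn_drawReal (ω : ℕ → unitInterval) (m : Memory) (a b : ℕ) :
    (m.drawReal ω a b).drawn = m.drawn + 1 := rfl

end Memory

attribute [simp] IExpr.eval RExpr.eval Test.holds Program.exec ivar iat rat

/-! ### Weighted choice -/

open scoped Classical in
/-- The index in `{0, …, n - 1}` that the random real `u` selects when `i` has weight `w i`. -/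
def pick (n : ℕ) (w : ℕ → ℝ) (u : ℝ) : ℕ :=
  ∑ i ∈ Finset.range (n - 1),
    if ∑ l ∈ Finset.range (i + 1), w l ≤ u * ∑ l ∈ Finset.range n, w l then 1 else 0

/-- Weighted choice. Input: number of items in integer cell `(5, 0)`, weights in real row `3`.
Output: index in integer cell `(5, 1)`. Scratch: integer row `6`, real row `4`. -/
def pickProgram : Program :=
  .seq (.setReal 4 0 (0 : IExpr)) <|
  .seq (forLoop 6 (ivar 5) (.setReal 4 0 (rat 4 0 + rat 3 (ivar 6)))) <|
  .seq (.seq (.draw 4 2) (.seq (.setReal 4 1 (0 : IExpr)) (.setInt 5 1 0)))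
  (forLoop 6 (ivar 5 - 1)
    (.seq (.setReal 4 1 (rat 4 1 + rat 3 (ivar 6)))
      (.ite (.realLt (rat 4 2 * rat 4 0) (rat 4 1)) .skip (.setInt 5 1 (iat 5 1 + 1)))))

/-- One loop finds the total weight, a second counts the partial sums not exceeding `u` times the
total. Scaling the draw instead of normalizing the weights avoids division. -/
theorem reaches_pickProgram (ω : ℕ → unitInterval) (m : Memory) :
    Reaches ω pickProgram (100 * (m.int 5 0 + 1)) (fun m' =>
      m'.int 5 0 = m.int 5 0 ∧ m'.int 5 1 = pick (m.int 5 0) (m.real 3) (ω m.drawn) ∧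
      m'.drawn = m.drawn + 1 ∧ (∀ a b, a ≠ 5 → a ≠ 6 → m'.int a b = m.int a b) ∧
      ∀ a b, a ≠ 4 → m'.real a b = m.real a b) m := by
  classical
  set N := m.int 5 0 with hN
  -- The loop terms come from `Reaches.forLoop`: `32 = 15 + 3 + 14` with body bound 15, and `62 = 43
  -- + 5 + 14` with body bound 43.
  refine Reaches.le (T := 1 + 6 + (1 + (N * 32 + 13) + (1 + 19 + ((N - 1) * 62 + 15)))) ?_ (by omega)
  refine Reaches.seq (T := 6) (Q' := fun m' => m' = m.writeReal 4 0 0) ?_ ?_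
  · exact Reaches.of_loopFree trivial (by decide) (by simp)
  rintro _ rfl
  refine Reaches.seq (Q' := fun m' => m'.real 4 0 = ∑ l ∈ Finset.range N, m.real 3 l ∧
      m'.drawn = m.drawn ∧ (∀ a b, a ≠ 6 → m'.int a b = m.int a b) ∧
      ∀ a b, a ≠ 4 → m'.real a b = m.real a b) ?_ ?_
  · refine (Reaches.forLoop (N := N) (T := 15) (fun i m' => m'.int 6 0 = i ∧
      m'.real 4 0 = ∑ l ∈ Finset.range i, m.real 3 l ∧
      m'.drawn = m.drawn ∧ (∀ a b, a ≠ 6 → m'.int a b = m.int a b) ∧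
      ∀ a b, a ≠ 4 → m'.real a b = m.real a b) ?_ ?_ ?_ ?_).mono ?_ ?_
    · simp +contextual
    · rintro i m' ⟨h, -⟩; exact h
    · rintro i m' ⟨-, -, -, h, -⟩; simp [h, hN]
    · rintro i m' hi ⟨h1, h2, h3, h4, h5⟩
      refine Reaches.of_loopFree trivial (by decide) ?_
      · simp +contextual [h1, h2, h3, h4, h5, Finset.sum_range_succ]
    · simp [IExpr.cost]
    · rintro m' ⟨-, h⟩; exact h
  rintro m1 ⟨h1, h2, h3, h4⟩
  refine Reaches.seq (Q' := fun m' => m'.real 4 0 = ∑ l ∈ Finset.range N, m.real 3 l ∧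
      m'.real 4 1 = 0 ∧ m'.real 4 2 = ω m.drawn ∧ m'.int 5 0 = N ∧ m'.int 5 1 = 0 ∧
      m'.drawn = m.drawn + 1 ∧ (∀ a b, a ≠ 5 → a ≠ 6 → m'.int a b = m.int a b) ∧
      ∀ a b, a ≠ 4 → m'.real a b = m.real a b) ?_ ?_
  · refine Reaches.of_loopFree (by simp [Program.LoopFree]) (by decide) ?_
    · simp +contextual [h1, h2, h3, h4, hN]
  rintro m2 ⟨k1, k2, k3, k4, k5, k6, k7, k8⟩
  refine (Reaches.forLoop (N := N - 1) (T := 43) (fun i m' => m'.int 6 0 = i ∧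
      m'.real 4 0 = ∑ l ∈ Finset.range N, m.real 3 l ∧
      m'.real 4 1 = ∑ l ∈ Finset.range i, m.real 3 l ∧ m'.real 4 2 = ω m.drawn ∧
      m'.int 5 0 = N ∧
      m'.int 5 1 = (∑ i ∈ Finset.range i, if ∑ l ∈ Finset.range (i + 1), m.real 3 l ≤
        (ω m.drawn : ℝ) * ∑ l ∈ Finset.range N, m.real 3 l then 1 else 0) ∧
      m'.drawn = m.drawn + 1 ∧ (∀ a b, a ≠ 5 → a ≠ 6 → m'.int a b = m.int a b) ∧
      ∀ a b, a ≠ 4 → m'.real a b = m.real a b) ?_ ?_ ?_ ?_).mono ?_ ?_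
  · simp +contextual [k1, k2, k3, k4, k5, k6, k7, k8]
  · rintro i m' ⟨h, -⟩; exact h
  · rintro i m' h; simp [h.2.2.2.2.1]
  · rintro i m' hi ⟨l1, l2, l3, l4, l5, l6, l7, l8, l9⟩
    refine Reaches.of_loopFree (by simp [Program.LoopFree]) (by decide) ?_
    by_cases hlt : (ω m.drawn : ℝ) * ∑ l ∈ Finset.range N, m.real 3 l <
        ∑ l ∈ Finset.range i, m.real 3 l + m.real 3 i
    · simp +contextual [l1, l2, l3, l4, l5, l6, l7, l8, l9, hlt, hlt.not_ge,
        Finset.sum_range_succ, -Finset.sum_boole]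
    · simp +contextual [l1, l2, l3, l4, l5, l6, l7, l8, l9, hlt, not_lt.1 hlt,
        Finset.sum_range_succ, -Finset.sum_boole]
  · exact le_rfl
  · rintro m' ⟨-, -, -, -, g1, g2, g3, g4, g5⟩
    exact ⟨g1, g2, g3, g4, g5⟩

/-- The full sum is not among the `n - 1` sums compared, so the index is in range even for `u = 1`
or vanishing weights. Every outcome of the draws thus leads to a legal run. -/
theorem pick_lt {n : ℕ} (hn : 0 < n) (w : ℕ → ℝ) (u : ℝ) : pick n w u < n := by
  classical
  unfold pick
  rw [← Finset.card_filter]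
  refine (Finset.card_filter_le _ _).trans_lt ?_
  rw [Finset.card_range]
  omega

theorem pick_congr {n : ℕ} {w w' : ℕ → ℝ} {u : ℝ} (h : ∀ i < n, w i = w' i) :
    pick n w u = pick n w' u := by
  have key : ∀ i ≤ n, ∑ l ∈ Finset.range i, w l = ∑ l ∈ Finset.range i, w' l := fun i hi =>
    Finset.sum_congr rfl fun l hl => h l ((Finset.mem_range.1 hl).trans_le hi)
  unfold pick
  refine Finset.sum_congr rfl fun i hi => ?_
  rw [key (i + 1) (by have := Finset.mem_range.1 hi; omega), key n le_rfl]

/-! ### The table of Eulerian numbers -/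

/-- The number of permutations of `n` elements with `j` increasing runs. -/
def runNumber : ℕ → ℕ → ℕ
  | 0, j => if j = 1 then 1 else 0
  | n + 1, j => j * runNumber n j + (n + 2 - j) * runNumber n (j - 1)

/-- Writes `runNumber n j` for `n ≤ d` and `j ≤ d + 1` to the real cells `(10 + n, j)`. -/
def tableProgram : Program :=
  .seq (.setReal 10 1 (1 : IExpr)) <|
  forLoop 7 (iat 0 0) <| forLoop 8 (iat 0 0 + 2) <|
    .setReal (10 + (ivar 7 + 1)) (ivar 8)
      ((ivar 8 : IExpr) * .get (10 + ivar 7) (ivar 8) +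
        (ivar 7 + 2 - ivar 8 : IExpr) * .get (10 + ivar 7) (ivar 8 - 1))

theorem reaches_tableProgram (ω : ℕ → unitInterval) (m : Memory) (hd : 1 ≤ m.int 0 0)
    (hm : ∀ j, m.real 10 j = 0) :
    Reaches ω tableProgram (1000 * m.int 0 0 ^ 2) (fun m' =>
      (∀ n ≤ m.int 0 0, ∀ j ≤ m.int 0 0 + 1, m'.real (10 + n) j = runNumber n j) ∧
      m'.drawn = m.drawn ∧ (∀ a b, a ≠ 7 → a ≠ 8 → m'.int a b = m.int a b) ∧
      ∀ a b, a < 10 → m'.real a b = m.real a b) m := by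
  set d := m.int 0 0 with hdef
  refine Reaches.le (T := 1 + 6 + (d * (((d + 2) * (60 + 5 + 14) + 5 + 10) + 3 + 14) + 3 + 10)) ?_
    (by nlinarith)
  refine Reaches.seq (Q' := fun m' => m' = m.writeReal 10 1 1) ?_ ?_
  · exact Reaches.of_loopFree trivial (by decide) (by simp)
  rintro _ rfl
  refine (Reaches.forLoop (N := d) (T := (d + 2) * (60 + 5 + 14) + 5 + 10) (fun i m' => m'.int 7 0 = i ∧
      (∀ n ≤ i, ∀ j ≤ d + 1, m'.real (10 + n) j = runNumber n j) ∧
      m'.drawn = m.drawn ∧ (∀ a b, a ≠ 7 → a ≠ 8 → m'.int a b = m.int a b) ∧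
      ∀ a b, a < 10 → m'.real a b = m.real a b) ?_ ?_ ?_ ?_).mono ?_ ?_
  -- Row zero of the table needs only the entry 1 in column 1; its other cells are still zero.
  · refine ⟨by simp, fun n hn j hj => ?_, rfl, ?_, ?_⟩
    · obtain rfl : n = 0 := by omega
      by_cases hj : j = 1 <;> simp [hj, hm, runNumber]
    · simp +contextual
    · intro a b hab
      have : a ≠ 10 := by omega
      simp [this]
  · exact fun i m' h => h.1
  · rintro i m' ⟨-, -, -, h, -⟩; simp [h, hdef]
  · rintro i m1 hi ⟨h1, h2, h3, h4, h5⟩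
    -- Columns `0, …, d + 1` make `d + 2` iterations. The row under construction is `11 + i = 10 +
    -- (i + 1)`.
    refine (Reaches.forLoop (N := d + 2) (T := 60) (fun j m' => m'.int 8 0 = j ∧ m'.int 7 0 = i ∧
      (∀ n ≤ i, ∀ j ≤ d + 1, m'.real (10 + n) j = runNumber n j) ∧
      (∀ j' < j, m'.real (11 + i) j' = runNumber (i + 1) j') ∧
      m'.drawn = m.drawn ∧ (∀ a b, a ≠ 7 → a ≠ 8 → m'.int a b = m.int a b) ∧
      ∀ a b, a < 10 → m'.real a b = m.real a b) ?_ ?_ ?_ ?_).mono ?_ ?_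
    · simp +contextual [h1, h2, h3, h4, h5]
    · exact fun i m' h => h.1
    · rintro j m' ⟨-, -, -, -, -, h, -⟩; simp [h, hdef]
    · rintro j m2 hj ⟨k1, k2, k3, k4, k5, k6, k7⟩
      refine Reaches.of_loopFree trivial (by decide) ?_
      have e1 := k3 i le_rfl j (by omega)
      have e2 := k3 i le_rfl (j - 1) (by omega)
      refine ⟨by simp [k1], by simp, by simp [k2], ?_, ?_, by simp [k5], by simp +contextual [k6], ?_⟩
      · intro n hn j' hj'
        have : n ≠ i + 1 := by omega
        simp [k2, this, k3 n hn j' hj']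
      · intro j' hj'
        have e : 11 + i = 10 + (i + 1) := by omega
        by_cases hjj : j' = j
        · subst hjj
          simp only [Program.exec, ivar, iat, IExpr.eval, k1, k2, RExpr.eval,
            IExpr.eval_sub, e1, e2, e]
          simp [runNumber]
        · simp [k2, k1, e, hjj]
          rw [← e]
          exact k4 j' (by omega)
      · intro a b hab
        have : a ≠ 10 + (i + 1) := by omega
        simp [this, k2, k7 a b hab]
    · exact le_rfl
    · rintro m2 ⟨k1, k2, k3, k4, k5, k6, k7⟩
      refine ⟨k2, by simp, ?_, by simp [k5], by simp +contextual [k6], by simpa using k7⟩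
      intro n hn j hj
      rcases Nat.lt_or_ge i n with hn' | hn'
      · obtain rfl : n = i + 1 := by omega
        have := k4 j (by omega)
        rw [show 11 + i = 10 + (i + 1) by omega] at this
        simpa using this
      · simpa using k3 n hn' j hj
  · exact le_rfl
  · rintro m' ⟨-, h⟩; exact h

/-! ### The choice of the slice and of the numbers of runs of the sub-permutations -/

/-- Weights of the two ways in which a permutation of `n + 1` elements with `j` runs arises from
one of `n` elements: inserting the maximum keeps the number of runs, or it creates a run. -/
def runWeights (n j : ℕ) (i : ℕ) : ℝ :=
  if i = 0 then (j : ℝ) * runNumber n j else ((n + 2 - j : ℕ) : ℝ) * runNumber n (j - 1)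

/-- The number of runs of the sampled permutation (`m = 0`), and of its restriction to the `d - m`
smallest values. -/
def level (d k : ℕ) (u : ℕ → ℝ) : ℕ → ℕ
  | 0 => 1 + pick (min k d) (fun i => runNumber d (i + 1)) (u 0)
  | m + 1 => level d k u m - pick 2 (runWeights (d - m - 1) (level d k u m)) (u (m + 1))

theorem level_le {d k : ℕ} (hd : 1 ≤ d) (hk : 1 ≤ k) (u : ℕ → ℝ) (m : ℕ) : level d k u m ≤ d := by
  induction m with
  | zero =>
    have := pick_lt (lt_min hk hd) (fun i => runNumber d (i + 1)) (u 0)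
    have := min_le_right k d
    simp only [level]; omega
  | succ m ih => exact (Nat.sub_le _ _).trans ih

/-- Writes `level (d - n)` to the integer cell `(3, n)` and `level 0` to `(1, 0)`. -/
def levelProgram : Program :=
  .seq (.setInt 9 0 (iat 0 1 - (iat 0 1 - iat 0 0))) <|
  .seq (forLoop 7 (ivar 9) (.setReal 3 (ivar 7) (.get (10 + iat 0 0) (ivar 7 + 1)))) <|
  .seq (.setInt 5 0 (ivar 9)) <|
  .seq pickProgram <|
  .seq (.seq (.setInt 3 (iat 0 0) (1 + iat 5 1)) <|
    .seq (.setInt 1 0 (iat 3 (iat 0 0))) (.setInt 5 0 2)) <|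
  forLoop 7 (iat 0 0) <|
    .seq (.seq (.setInt 9 1 (iat 0 0 - ivar 7 - 1)) <|
      .seq (.setInt 9 2 (iat 3 (iat 9 1 + 1))) <|
      .seq (.setReal 3 0 ((iat 9 2 : IExpr) * .get (10 + iat 9 1) (iat 9 2)))
        (.setReal 3 1
          ((iat 9 1 + 2 - iat 9 2 : IExpr) * .get (10 + iat 9 1) (iat 9 2 - 1)))) <|
    .seq pickProgram (.setInt 3 (iat 9 1) (iat 9 2 - iat 5 1))

/-- The time is linear: one choice among at most `d` items, then `d` choices between two items. They
use draws `0, …, d`. -/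
theorem reaches_levelProgram (ω : ℕ → unitInterval) (m : Memory) {d k : ℕ} (hd : 1 ≤ d) (hk : 1 ≤ k)
    (hmd : m.int 0 0 = d) (hmk : m.int 0 1 = k) (hm : m.drawn = 0)
    (htab : ∀ n ≤ d, ∀ j ≤ d + 1, m.real (10 + n) j = runNumber n j) :
    Reaches ω levelProgram (2000 * d) (fun m' =>
      (∀ i ≤ d, m'.int 3 i = level d k (fun l => ω l) (d - i)) ∧
      m'.int 1 0 = level d k (fun l => ω l) 0 ∧
      m'.drawn = d + 1 ∧ (∀ b, m'.int 0 b = m.int 0 b) ∧ (∀ a b, 10 ≤ a → m'.int a b = m.int a b)) m := by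
  have hK : min k d ≤ d := min_le_right _ _
  have hKd := Nat.mul_le_mul_right 40 hK
  refine Reaches.le (T := 1 + 20 + (1 + (min k d * (20 + 3 + 14) + 3 + 10) + (1 + 20 +
    (1 + (100 * (min k d + 1)) + (1 + 50 + (d * ((1 + 200 + (1 + 300 + 20)) + 3 + 14) + 3 + 10))))))
    ?_ (by omega)
  refine Reaches.seq (Q' := fun m' => m' = m.writeInt 9 0 (min k d)) ?_ ?_
  · refine Reaches.of_loopFree trivial (by decide) ?_
    -- Truncated subtraction yields the minimum. Capping `k` at `d` makes the running time
    -- independent of `k`, and loses nothing because no permutation has `d` or more ascents.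
    have : k - (k - d) = min k d := by omega
    simp [hmd, hmk, this]
  rintro _ rfl
  refine Reaches.seq (Q' := fun m' => (∀ i < min k d, m'.real 3 i = runNumber d (i + 1)) ∧
    m'.int 9 0 = min k d ∧ m'.drawn = 0 ∧ (∀ b, m'.int 0 b = m.int 0 b) ∧
    (∀ a b, 10 ≤ a → m'.int a b = m.int a b) ∧ ∀ a b, a ≠ 3 → m'.real a b = m.real a b) ?_ ?_
  · refine (Reaches.forLoop (N := min k d) (T := 20) (fun i m' => m'.int 7 0 = i ∧
      (∀ i' < i, m'.real 3 i' = runNumber d (i' + 1)) ∧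
      m'.int 9 0 = min k d ∧ m'.drawn = 0 ∧ (∀ b, m'.int 0 b = m.int 0 b) ∧
      (∀ a b, 10 ≤ a → m'.int a b = m.int a b) ∧ ∀ a b, a ≠ 3 → m'.real a b = m.real a b)
      ?_ ?_ ?_ ?_).mono ?_ ?_
    · refine ⟨by simp, by simp, by simp, by simp [hm], by simp, fun a b h => ?_, by simp⟩
      have h1 : a ≠ 9 := by omega
      have h2 : a ≠ 7 := by omega
      simp [h1, h2]
    · exact fun i m' h => h.1
    · rintro i m' ⟨-, -, h, -⟩; simp [h]
    · rintro i m1 hi ⟨h1, h2, h3, h4, h5, h6, h7⟩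
      refine Reaches.of_loopFree trivial (by decide) ?_
      refine ⟨by simp [h1], by simp, ?_, by simp [h3], by simp [h4], by simp [h5], fun a b h => ?_,
        by simp +contextual [h7]⟩
      · intro i' hi'
        have e := htab d le_rfl (i + 1) (by omega)
        have hne : 10 + d ≠ 3 := by omega
        by_cases hii : i' = i
        · simp [hii, h1, h5, hmd, h7 _ _ hne, e]
        · simp [hii, h1, h2 i' (by omega)]
      · have : a ≠ 7 := by omega
        simp [this, h6 a b h]
    · exact le_rfl
    · rintro m' ⟨-, h⟩; exact h
  rintro m1 ⟨h1, h2, h3, h4, h5, h6⟩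
  refine Reaches.seq (Q' := fun m' => m' = m1.writeInt 5 0 (min k d)) ?_ ?_
  · exact Reaches.of_loopFree trivial (by decide) (by simp [h2])
  rintro _ rfl
  refine Reaches.seq ((reaches_pickProgram ω _).le (by simp)) ?_
  rintro m2 ⟨k1, k2, k3, k4, k5⟩
  simp only [Memory.int_writeInt, Memory.real_writeInt, Memory.drawn_writeInt] at k1 k2 k3 k4 k5
  have hlev : m2.int 5 1 + 1 = level d k (fun l => ω l) 0 := by
    rw [k2, level, h3, add_comm]
    simp only [and_self, if_true]
    rw [pick_congr h1]
  refine Reaches.seq (Q' := fun m' => m'.int 3 d = level d k (fun l => ω l) 0 ∧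
      m'.int 1 0 = level d k (fun l => ω l) 0 ∧ m'.int 5 0 = 2 ∧
      m'.drawn = 1 ∧ (∀ b, m'.int 0 b = m.int 0 b) ∧ (∀ a b, 10 ≤ a → m'.int a b = m.int a b) ∧
      ∀ a b, 10 ≤ a → m'.real a b = m.real a b) ?_ ?_
  · refine Reaches.of_loopFree (by simp [Program.LoopFree]) (by decide) ?_
    have hd0 : m2.int 0 0 = d := by rw [k4 _ _ (by decide) (by decide)]; simp [h4, hmd]
    refine ⟨?_, ?_, by simp, by simp [k3, h3], fun b => ?_, fun a b h => ?_, fun a b h => ?_⟩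
    · simp [hd0, ← hlev, add_comm]
    · simp [hd0, ← hlev, add_comm]
    · simp [k4, h4]
    · simp [show a ≠ 3 by omega, show a ≠ 1 by omega, show a ≠ 5 by omega]
      rw [k4 _ _ (by omega) (by omega)]
      simp [show a ≠ 5 by omega, h5 a b h]
    · simp [k5 a b (by omega), h6 a b (by omega)]
  rintro m3 ⟨l1, l2, l3, l4, l5, l6, l7⟩
  refine (Reaches.forLoop (N := d) (T := 1 + 200 + (1 + 300 + 20)) (fun i m' => m'.int 7 0 = i ∧
      (∀ n ≤ d, d ≤ n + i → m'.int 3 n = level d k (fun l => ω l) (d - n)) ∧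
      m'.int 1 0 = level d k (fun l => ω l) 0 ∧ m'.int 5 0 = 2 ∧
      m'.drawn = i + 1 ∧ (∀ b, m'.int 0 b = m.int 0 b) ∧ (∀ a b, 10 ≤ a → m'.int a b = m.int a b) ∧
      ∀ a b, 10 ≤ a → m'.real a b = m.real a b) ?_ ?_ ?_ ?_).mono ?_ ?_
  · refine ⟨by simp, fun n hn hn' => ?_, by simp [l2], by simp [l3], by simp [l4], by simp [l5],
      fun a b h => ?_, by simpa using l7⟩
    · obtain rfl : n = d := by omega
      simp [l1]
    · simp [show a ≠ 7 by omega, l6 a b h]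
  · exact fun i m' h => h.1
  · rintro i m' ⟨-, -, -, -, -, h, -⟩; simp [h, hmd]
  · rintro i m4 hi ⟨g1, g2, g3, g4, g5, g6, g7, g8⟩
    refine Reaches.seq (Q' := fun m' => m'.int 7 0 = i ∧ m'.int 9 1 = d - i - 1 ∧
      m'.int 9 2 = level d k (fun l => ω l) i ∧
      (∀ b < 2, m'.real 3 b = runWeights (d - i - 1) (level d k (fun l => ω l) i) b) ∧
      (∀ n ≤ d, d ≤ n + i → m'.int 3 n = level d k (fun l => ω l) (d - n)) ∧
      m'.int 1 0 = level d k (fun l => ω l) 0 ∧ m'.int 5 0 = 2 ∧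
      m'.drawn = i + 1 ∧ (∀ b, m'.int 0 b = m.int 0 b) ∧ (∀ a b, 10 ≤ a → m'.int a b = m.int a b) ∧
      ∀ a b, 10 ≤ a → m'.real a b = m.real a b) ?_ ?_
    · refine Reaches.of_loopFree (by simp [Program.LoopFree]) (by decide) ?_
      have hd0 : m4.int 0 0 = d := by rw [g6, hmd]
      have hJ : m4.int 3 (d - i - 1 + 1) = level d k (fun l => ω l) i := by
        rw [g2 _ (by omega) (by omega)]; congr 1; omega
      -- This keeps both table lookups within the columns that were filled in, whatever the draws
      -- were.
      have hle := (level_le hd hk (fun l => ω l) i).trans d.le_succ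
      have e1 := fun j hj => (g8 (10 + (d - i - 1)) j (by omega)).trans (htab (d - i - 1) (by omega) j hj)
      refine ⟨by simp [g1], by simp [g1, hd0], by simp [g1, hd0, hJ], ?_, ?_, by simp [g3],
        by simp [g4], by simp [g5], by simp [g6], fun a b h => ?_, fun a b h => ?_⟩
      · intro b hb
        simp only [Program.exec]
        interval_cases b
        · simp [g1, hd0, hJ, runWeights, e1 _ hle]
        · simp [g1, hd0, hJ, runWeights, e1 _ ((Nat.sub_le _ 1).trans hle),
            show 10 + (d - i - 1) ≠ 3 by omega]
      · intro n hn hn'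
        simp [g2 n hn hn']
      · simp [show a ≠ 9 by omega, g7 a b h]
      · simp [show a ≠ 3 by omega, g8 a b h]
    rintro m5 ⟨f1, f2, f3, f4, f5, f6, f7, f8, f9, f10, f11⟩
    refine Reaches.seq ((reaches_pickProgram ω _).le (by simp [f7])) ?_
    rintro m6 ⟨e1, e2, e3, e4, e5⟩
    have hlev : m5.int 9 2 - m6.int 5 1 = level d k (fun l => ω l) (i + 1) := by
      rw [e2, level, f3, f7, f8, pick_congr f4]
    refine Reaches.of_loopFree trivial (by decide) ?_
    have a91 : m6.int 9 1 = d - i - 1 := by rw [e4 _ _ (by decide) (by decide), f2]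
    have a92 : m6.int 9 2 = m5.int 9 2 := e4 _ _ (by decide) (by decide)
    refine ⟨by simp [e4, f1], by simp, ?_, by simp [e4, f6], by simp [e1, f7], by simp [e3, f8],
      by simp [e4, f9], fun a b h => ?_, fun a b h => ?_⟩
    · intro n hn hn'
      by_cases hnn : n = d - i - 1
      · have : d - n = i + 1 := by omega
        simp only [this, ← hlev]
        simp [hnn, a91, a92]
      · simp [a91, hnn, e4, f5 n hn (by omega)]
    · simp [show a ≠ 3 by omega, show a ≠ 7 by omega, e4 a b (by omega) (by omega), f10 a b h]
    · simp [e5 a b (by omega), f11 a b h]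
  · exact le_rfl
  · rintro m' ⟨-, g2, g3, -, g5, g6, g7, g8⟩
    exact ⟨fun n hn => g2 n hn (by omega), g3, g5, g6, g7⟩

/-! ### The permutation -/

/-- Inserting the maximum `n` into the sequence `w 0, …, w (n - 1)` before position `p` keeps the
number of increasing runs. -/
def KeepsRuns (n : ℕ) (w : ℕ → ℕ) (p : ℕ) : Prop := p = 0 ∨ p < n ∧ w (p - 1) < w p

/-- The sequence `w 0, …, w (n - 1)` with `n` inserted before position `p`. -/
def insertMax (n p : ℕ) (w : ℕ → ℕ) (i : ℕ) : ℕ := if i < p then w i else if i = p then n else w (i - 1)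

open scoped Classical in
/-- Weights of the positions at which the maximum is inserted. -/
def gapWeights (n : ℕ) (w : ℕ → ℕ) (keep : Prop) (p : ℕ) : ℝ :=
  if KeepsRuns n w p ↔ keep then 1 else 0

/-- The restriction of the sampled permutation to the `n` smallest values. -/
def word (d k : ℕ) (u : ℕ → ℝ) : ℕ → ℕ → ℕ
  | 0 => fun _ => 0
  | n + 1 => insertMax n (pick (n + 1) (gapWeights n (word d k u n)
      (level d k u (d - n) = level d k u (d - (n + 1)))) (u (d + 1 + n))) (word d k u n)

/-- Writes `word n` to the integer row `10 + n` and `word d` to the integer row `2`. -/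
def wordProgram : Program :=
  .seq (forLoop 7 (iat 0 0) <|
    .seq (forLoop 8 (ivar 7 + 1) <|
      .seq (.ite (.intEq (ivar 8) 0) (.setInt 9 1 1) <|
        .ite (.and (.intLt (ivar 8) (ivar 7))
          (.intLt (.get (10 + ivar 7) (ivar 8 - 1)) (.get (10 + ivar 7) (ivar 8))))
          (.setInt 9 1 1) (.setInt 9 1 0)) <|
      .ite (.intEq (iat 3 (ivar 7)) (iat 3 (ivar 7 + 1))) (.setReal 3 (ivar 8) (iat 9 1))
        (.setReal 3 (ivar 8) (1 - iat 9 1 : IExpr))) <|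
    .seq (.setInt 5 0 (ivar 7 + 1)) <|
    .seq pickProgram <|
    forLoop 8 (ivar 7 + 1) <|
      .ite (.intLt (ivar 8) (iat 5 1))
        (.setInt (10 + (ivar 7 + 1)) (ivar 8) (.get (10 + ivar 7) (ivar 8))) <|
      .ite (.intEq (ivar 8) (iat 5 1))
        (.setInt (10 + (ivar 7 + 1)) (ivar 8) (ivar 7))
        (.setInt (10 + (ivar 7 + 1)) (ivar 8) (.get (10 + ivar 7) (ivar 8 - 1)))) <|
  forLoop 7 (iat 0 0) <| .setInt 2 (ivar 7) (.get (10 + iat 0 0) (ivar 7))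

/-- Every insertion copies row `10 + n` into the next row, so nothing is shifted in place. Weighting
the gaps, picking one and copying are each linear in `n`, which makes the whole construction
quadratic. -/
theorem reaches_wordProgram (ω : ℕ → unitInterval) (m : Memory) {d k : ℕ} (hd : 1 ≤ d)
    (hmd : m.int 0 0 = d) (hm : m.drawn = d + 1)
    (hlev : ∀ n ≤ d, m.int 3 n = level d k (fun l => ω l) (d - n)) :
    Reaches ω wordProgram (2000 * d ^ 2) (fun m' =>
      (∀ i < d, m'.int 2 i = word d k (fun l => ω l) d i) ∧
      m'.drawn = 2 * d + 1 ∧ m'.int 0 0 = d ∧ m'.int 1 0 = m.int 1 0) m := by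
  classical
  have hdd : d ≤ d ^ 2 := by nlinarith
  refine Reaches.le (T := 1 + (d * ((1 + ((d + 1) * (160 + 5 + 14) + 5 + 10) + (1 + 20 +
    (1 + 100 * (d + 2) + ((d + 1) * (160 + 5 + 14) + 5 + 10)))) + 3 + 14) + 3 + 10) +
    (d * (20 + 3 + 14) + 3 + 10)) ?_ (by nlinarith)
  refine Reaches.seq (Q' := fun m' => (∀ n ≤ d, ∀ l < n, m'.int (10 + n) l = word d k (fun l => ω l) n l) ∧
      m'.drawn = 2 * d + 1 ∧ m'.int 0 0 = d ∧ m'.int 1 0 = m.int 1 0) ?_ ?_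
  · refine (Reaches.forLoop (N := d) (T := (1 + ((d + 1) * (160 + 5 + 14) + 5 + 10) + (1 + 20 +
      (1 + 100 * (d + 2) + ((d + 1) * (160 + 5 + 14) + 5 + 10))))) (fun i m' => m'.int 7 0 = i ∧
      (∀ n ≤ i, ∀ l < n, m'.int (10 + n) l = word d k (fun l => ω l) n l) ∧
      m'.drawn = d + 1 + i ∧ m'.int 0 0 = d ∧ m'.int 1 0 = m.int 1 0 ∧
      ∀ b, m'.int 3 b = m.int 3 b) ?_ ?_ ?_ ?_).mono ?_ ?_
    · refine ⟨by simp, fun n hn l hl => by omega, by simp [hm], by simp [hmd], by simp, by simp⟩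
    · exact fun i m' h => h.1
    · rintro i m' ⟨-, -, -, h, -⟩; simp [h]
    · rintro i m1 hi ⟨h1, h2, h3, h4, h5, h6⟩
      set w := word d k (fun l => (ω l : ℝ)) i with hw
      set keep : Prop := level d k (fun l => (ω l : ℝ)) (d - i) =
        level d k (fun l => (ω l : ℝ)) (d - (i + 1)) with hkeep
      refine Reaches.seq (Q' := fun m' => m'.int 7 0 = i ∧
        (∀ p < i + 1, m'.real 3 p = gapWeights i w keep p) ∧
        (∀ n ≤ i, ∀ l < n, m'.int (10 + n) l = word d k (fun l => ω l) n l) ∧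
        m'.drawn = d + 1 + i ∧ m'.int 0 0 = d ∧ m'.int 1 0 = m.int 1 0 ∧
        ∀ b, m'.int 3 b = m.int 3 b) ?_ ?_
      · refine (Reaches.forLoop (N := i + 1) (T := 160) (fun j m' => m'.int 8 0 = j ∧
          m'.int 7 0 = i ∧
          (∀ p < j, m'.real 3 p = gapWeights i w keep p) ∧
          (∀ n ≤ i, ∀ l < n, m'.int (10 + n) l = word d k (fun l => ω l) n l) ∧
          m'.drawn = d + 1 + i ∧ m'.int 0 0 = d ∧ m'.int 1 0 = m.int 1 0 ∧
          ∀ b, m'.int 3 b = m.int 3 b) ?_ ?_ ?_ ?_).mono ?_ ?_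
        · refine ⟨by simp, by simp [h1], by simp, fun n hn l hl => ?_, by simp [h3], by simp [h4],
            by simp [h5], by simp [h6]⟩
          simp [h2 n hn l hl, show 10 + n ≠ 8 by omega]
        · exact fun i m' h => h.1
        · rintro j m' ⟨-, h, -⟩; simp [h]
        · rintro j m2 hj ⟨k1, k2, k3, k4, k5, k6, k7, k8⟩
          refine Reaches.of_loopFree (by simp [Program.LoopFree]) (by decide) ?_
          have hk1 : m2.int 3 i = level d k (fun l => (ω l : ℝ)) (d - i) := by
            rw [k8, hlev _ hi.le]
          have hk2 : m2.int 3 (i + 1) = level d k (fun l => (ω l : ℝ)) (d - (i + 1)) := by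
            rw [k8, hlev _ hi]
          have ht : (j < i ∧ m2.int (10 + i) (j - 1) < m2.int (10 + i) j) ↔
              j < i ∧ w (j - 1) < w j :=
            and_congr_right fun hji => by
              rw [k4 i le_rfl j hji, k4 i le_rfl (j - 1) (by omega)]
          have hkk : (m2.int 3 i = m2.int 3 (i + 1)) ↔ keep := by rw [hk1, hk2]
          have ex : (Program.seq (.ite (.intEq (ivar 8) 0) (.setInt 9 1 1) <|
              .ite (.and (.intLt (ivar 8) (ivar 7))
                (.intLt (.get (10 + ivar 7) (ivar 8 - 1)) (.get (10 + ivar 7) (ivar 8))))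
                (.setInt 9 1 1) (.setInt 9 1 0)) <|
              .ite (.intEq (iat 3 (ivar 7)) (iat 3 (ivar 7 + 1))) (.setReal 3 (ivar 8) (iat 9 1))
                (.setReal 3 (ivar 8) (1 - iat 9 1 : IExpr))).exec ω m2 =
              (m2.writeInt 9 1 (if KeepsRuns i w j then 1 else 0)).writeReal 3 j
                (gapWeights i w keep j) := by
            simp only [Program.exec, Test.holds, IExpr.eval_sub,
              ivar, iat, IExpr.eval, k1, k2, ht]
            by_cases c1 : j = 0 <;> by_cases c2 : (j < i ∧ w (j - 1) < w j) <;>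
              by_cases c3 : keep <;>
              simp [c1, c2, c3, hkk, k1, k2, KeepsRuns, gapWeights]
          rw [ex]
          refine ⟨by simp [k1], by simp, by simp [k2], fun p hp => ?_, fun n hn l hl => ?_,
            by simp [k5], by simp [k6], by simp [k7], by simp [k8]⟩
          · by_cases hpj : p = j
            · simp [hpj]
            · simp [hpj, k3 p (by omega)]
          · simp [show 10 + n ≠ 8 by omega, show 10 + n ≠ 9 by omega, k4 n hn l hl]
        · have := Nat.mul_le_mul_right (160 + 5 + 14) (show i + 1 ≤ d + 1 by omega)
          exact Nat.add_le_add_right (Nat.add_le_add_right this 5) 10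
        · rintro m' ⟨-, h⟩; exact h
      rintro m2 ⟨k1, k2, k3, k4, k5, k6, k7⟩
      refine Reaches.seq (Q' := fun m' => m' = m2.writeInt 5 0 (i + 1)) ?_ ?_
      · exact Reaches.of_loopFree trivial (by decide) (by simp [k1])
      rintro _ rfl
      refine Reaches.seq ((reaches_pickProgram ω _).le (T' := 100 * (d + 2)) (by simp; omega)) ?_
      rintro m3 ⟨-, l2, l3, l4, -⟩
      simp only [Memory.int_writeInt, Memory.real_writeInt, Memory.drawn_writeInt, and_self,
        if_true, k4] at l2 l3 l4
      have hp : m3.int 5 1 = pick (i + 1) (gapWeights i w keep) (ω (d + 1 + i)) := by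
        rw [l2, pick_congr k2]
      refine (Reaches.forLoop (N := i + 1) (T := 160) (fun j m' => m'.int 8 0 = j ∧
          m'.int 7 0 = i ∧
          (∀ l < j, m'.int (10 + (i + 1)) l = word d k (fun l => ω l) (i + 1) l) ∧
          (∀ n ≤ i, ∀ l < n, m'.int (10 + n) l = word d k (fun l => ω l) n l) ∧
          m'.int 5 1 = m3.int 5 1 ∧
          m'.drawn = d + 1 + i + 1 ∧ m'.int 0 0 = d ∧ m'.int 1 0 = m.int 1 0 ∧
          ∀ b, m'.int 3 b = m.int 3 b) ?_ ?_ ?_ ?_).mono ?_ ?_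
      · refine ⟨by simp, by simp [l4, k1], by simp, fun n hn l hl => ?_, by simp, by simp [l3],
          by simp [l4, k5], by simp [l4, k6], by simp [l4, k7]⟩
        simp [show 10 + n ≠ 8 by omega, show 10 + n ≠ 5 by omega,
          l4 (10 + n) l (by omega) (by omega), k3 n hn l hl]
      · exact fun i m' h => h.1
      · rintro j m' ⟨-, h, -⟩; simp [h]
      · rintro j m4 hj ⟨g1, g2, g3, g4, g5, g6, g7, g8, g9⟩
        refine Reaches.of_loopFree (by simp [Program.LoopFree]) (by decide) ?_
        -- An insertion position of at most `i` ensures that all entries copied from row `10 + i`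
        -- are among its `i` valid ones.
        have hpi : m3.int 5 1 < i + 1 := hp ▸ pick_lt i.succ_pos _ _
        have ex : (Program.ite (.intLt (ivar 8) (iat 5 1))
            (.setInt (10 + (ivar 7 + 1)) (ivar 8) (.get (10 + ivar 7) (ivar 8))) <|
            .ite (.intEq (ivar 8) (iat 5 1))
            (.setInt (10 + (ivar 7 + 1)) (ivar 8) (ivar 7))
            (.setInt (10 + (ivar 7 + 1)) (ivar 8) (.get (10 + ivar 7) (ivar 8 - 1)))).exec ω m4 =
            m4.writeInt (10 + (i + 1)) j (word d k (fun l => ω l) (i + 1) j) := by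
          simp only [Program.exec, Test.holds, IExpr.eval_sub,
              ivar, iat, IExpr.eval, g1, g2, g5, word, insertMax, ← hw, ← hkeep, ← hp]
          split_ifs with c1 c2
          · rw [g4 i le_rfl j (by omega)]
          · rfl
          · rw [g4 i le_rfl (j - 1) (by omega)]
        rw [ex]
        have h8 : 8 ≠ 10 + (i + 1) := by omega
        have h7 : 7 ≠ 10 + (i + 1) := by omega
        have h5 : 5 ≠ 10 + (i + 1) := by omega
        have h3 : 3 ≠ 10 + (i + 1) := by omega
        refine ⟨by simp [g1, h8], by simp, by simp [g2, h7], fun l hl => ?_, fun n hn l hl => ?_,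
          by simp [g5, h5], by simp [g6],
          by simp [g7, show 0 ≠ 10 + (i + 1) by omega],
          by simp [g8, show 1 ≠ 10 + (i + 1) by omega], by simp [g9, h3]⟩
        · by_cases hlj : l = j
          · simp [hlj, h8.symm]
          · simp [hlj, h8.symm, g3 l (by omega)]
        · simp [show 10 + n ≠ 8 by omega, show n ≠ i + 1 by omega, g4 n hn l hl]
      · have := Nat.mul_le_mul_right (160 + 5 + 14) (show i + 1 ≤ d + 1 by omega)
        exact Nat.add_le_add_right (Nat.add_le_add_right this 5) 10
      · rintro m' ⟨-, g2, g3, g4, -, g6, g7, g8, g9⟩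
        refine ⟨g2, by simp, fun n hn l hl => ?_, by simp [g6, add_assoc], by simp [g7],
          by simp [g8], by simp [g9]⟩
        rcases Nat.lt_or_ge i n with hn' | hn'
        · obtain rfl : n = i + 1 := by omega
          simpa [show 10 + (i + 1) ≠ 7 by omega] using g3 l hl
        · simpa [show 10 + n ≠ 7 by omega] using g4 n hn' l hl
    · exact le_rfl
    · rintro m' ⟨-, h2, h3, h4, h5, -⟩
      exact ⟨h2, by omega, h4, h5⟩
  rintro m1 ⟨h1, h2, h3, h4⟩
  refine (Reaches.forLoop (N := d) (T := 20) (fun i m' => m'.int 7 0 = i ∧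
    (∀ l < i, m'.int 2 l = word d k (fun l => ω l) d l) ∧
    (∀ l < d, m'.int (10 + d) l = word d k (fun l => ω l) d l) ∧
      m'.drawn = 2 * d + 1 ∧ m'.int 0 0 = d ∧ m'.int 1 0 = m.int 1 0) ?_ ?_ ?_ ?_).mono ?_ ?_
  · refine ⟨by simp, by simp, fun l hl => ?_, by simp [h2], by simp [h3], by simp [h4]⟩
    simp [show 10 + d ≠ 7 by omega, h1 d le_rfl l hl]
  · exact fun i m' h => h.1
  · rintro i m' ⟨-, -, -, -, h, -⟩; simp [h]
  · rintro i m2 hi ⟨k1, k2, k3, k4, k5, k6⟩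
    refine Reaches.of_loopFree trivial (by decide) ?_
    refine ⟨by simp [k1], by simp, fun l hl => ?_, fun l hl => ?_, by simp [k4], by simp [k5],
      by simp [k6]⟩
    · by_cases hli : l = i
      · simp [hli, k1, k5, k3 i hi]
      · simp [hli, k1, k2 l (by omega)]
    · simp [show 10 + d ≠ 7 by omega, show 10 + d ≠ 2 by omega, k3 l hl]
  · exact le_rfl
  · rintro m' ⟨-, k2, -, k4, k5, k6⟩
    exact ⟨k2, k4, k5, k6⟩

@[simp] theorem Memory.writeReal_writeReal (m : Memory) (a b : ℕ) (v v' : ℝ) :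
    (m.writeReal a b v).writeReal a b v' = m.writeReal a b v' := by
  simp only [Memory.writeReal, Memory.mk.injEq, true_and, and_true]
  funext a' b'
  split_ifs <;> rfl

/-! ### The point of the simplex, the signs and the output -/

open scoped Classical in
/-- The number of entries of `v 0, …, v (d - 1)` below `v i`. -/
def rank (d : ℕ) (v : ℕ → ℝ) (i : ℕ) : ℕ := ∑ l ∈ Finset.range d, if v l < v i then 1 else 0

/-- Writes `d` random reals to the real row `5` and sorts them into the real row `1`. -/
def simplexProgram : Program :=
  .seq (forLoop 7 (iat 0 0) (.draw 5 (ivar 7))) <|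
  forLoop 7 (iat 0 0) <|
    .seq (.setInt 9 1 0) <|
    .seq (forLoop 8 (iat 0 0) <|
      .ite (.realLt (rat 5 (ivar 8)) (rat 5 (ivar 7))) (.setInt 9 1 (iat 9 1 + 1)) .skip) <|
    .setReal 1 (iat 9 1) (rat 5 (ivar 7))

/-- Sorting by ranks takes quadratic time and only comparisons. Ties would write two values to the
same cell, so the contents are described only for injective ranks; the step bound and the frame
conditions are unconditional. -/
theorem reaches_simplexProgram (ω : ℕ → unitInterval) (m : Memory) {d a : ℕ} (hd : 1 ≤ d)
    (hmd : m.int 0 0 = d) (hm : m.drawn = a) :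
    Reaches ω simplexProgram (1000 * d ^ 2) (fun m' =>
      (Set.InjOn (rank d fun l => ω (a + l)) (Set.Iio d) →
        ∀ i < d, m'.real 1 (rank d (fun l => ω (a + l)) i) = ω (a + i)) ∧
      m'.drawn = a + d ∧ ∀ a b, a < 7 → m'.int a b = m.int a b) m := by
  classical
  have hdd : d ≤ d ^ 2 := by nlinarith
  refine Reaches.le (T := 1 + (d * (6 + 3 + 14) + 3 + 10) +
    (d * ((1 + 6 + (1 + (d * (40 + 3 + 14) + 3 + 10) + 20)) + 3 + 14) + 3 + 10)) ?_ (by nlinarith)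
  refine Reaches.seq (Q' := fun m' => (∀ i < d, m'.real 5 i = ω (a + i)) ∧
      m'.drawn = a + d ∧ ∀ a b, a < 7 → m'.int a b = m.int a b) ?_ ?_
  · refine (Reaches.forLoop (N := d) (T := 6) (fun i m' => m'.int 7 0 = i ∧
      (∀ j < i, m'.real 5 j = ω (a + j)) ∧
      m'.drawn = a + i ∧ ∀ a b, a < 7 → m'.int a b = m.int a b) ?_ ?_ ?_ ?_).mono ?_ ?_
    · refine ⟨by simp, by simp, by simp [hm], fun a b h => ?_⟩
      simp [show a ≠ 7 by omega]
    · exact fun i m' h => h.1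
    · rintro i m' ⟨-, -, -, h⟩; simp [h, hmd]
    · rintro i m1 hi ⟨h1, h2, h3, h4⟩
      refine Reaches.of_loopFree trivial (by decide) ?_
      refine ⟨by simp [h1], by simp, fun j hj => ?_, by simp [h3, add_assoc], fun a b h => ?_⟩
      · by_cases hji : j = i
        · simp [hji, h1, h3]
        · simp [hji, h1, h2 j (by omega)]
      · simp [show a ≠ 7 by omega, h4 a b h]
    · exact le_rfl
    · rintro m' ⟨-, h⟩; exact h
  rintro m1 ⟨h1, h2, h3⟩
  set v : ℕ → ℝ := fun l => ω (a + l) with hv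
  refine (Reaches.forLoop (N := d) (T := (1 + 6 + (1 + (d * (40 + 3 + 14) + 3 + 10) + 20)))
    (fun i m' => m'.int 7 0 = i ∧ (∀ i < d, m'.real 5 i = v i) ∧
      (Set.InjOn (rank d v) (Set.Iio d) → ∀ j < i, m'.real 1 (rank d v j) = v j) ∧
      m'.drawn = a + d ∧ ∀ a b, a < 7 → m'.int a b = m.int a b) ?_ ?_ ?_ ?_).mono ?_ ?_
  · refine ⟨by simp, by simpa using h1, by simp, by simp [h2], fun a b h => ?_⟩
    simp [show a ≠ 7 by omega, h3 a b h]
  · exact fun i m' h => h.1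
  · rintro i m' ⟨-, -, -, -, h⟩; simp [h, hmd]
  · rintro i m2 hi ⟨k1, k2, k3, k4, k5⟩
    refine Reaches.seq (Q' := fun m' => m' = m2.writeInt 9 1 0) ?_ ?_
    · exact Reaches.of_loopFree trivial (by decide) (by simp)
    rintro _ rfl
    refine Reaches.seq (Q' := fun m' => m'.int 7 0 = i ∧ m'.int 9 1 = rank d v i ∧
      m'.real = m2.real ∧ m'.drawn = a + d ∧ ∀ a b, a < 7 → m'.int a b = m.int a b) ?_ ?_
    · refine (Reaches.forLoop (N := d) (T := 40)
        (fun j m' => m'.int 8 0 = j ∧ m'.int 7 0 = i ∧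
          m'.int 9 1 = (∑ l ∈ Finset.range j, if v l < v i then 1 else 0) ∧
          m'.real = m2.real ∧ m'.drawn = a + d ∧
          ∀ a b, a < 7 → m'.int a b = m.int a b) ?_ ?_ ?_ ?_).mono ?_ ?_
      · refine ⟨by simp, by simp [k1], by simp, by simp, by simp [k4], fun a b h => ?_⟩
        simp [show a ≠ 8 by omega, show a ≠ 9 by omega, k5 a b h]
      · exact fun i m' h => h.1
      · rintro i m' ⟨-, -, -, -, -, h⟩; simp [h, hmd]
      · rintro j m3 hj ⟨g1, g2, g3, g4, g5, g6⟩
        refine Reaches.of_loopFree (by simp [Program.LoopFree]) (by decide) ?_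
        have ex : (Program.ite (.realLt (rat 5 (ivar 8)) (rat 5 (ivar 7)))
            (.setInt 9 1 (iat 9 1 + 1)) .skip).exec ω m3 =
            if v j < v i then m3.writeInt 9 1 (m3.int 9 1 + 1) else m3 := by
          simp [g1, g2, g4, k2 j hj, k2 i hi]
        rw [ex, Finset.sum_range_succ, ← g3]
        split_ifs with c
        · refine ⟨by simp [g1], by simp, by simp [g2], by simp, by simp [g4], by simp [g5],
            fun a b h => ?_⟩
          simp [show a ≠ 8 by omega, show a ≠ 9 by omega, g6 a b h]
        · refine ⟨by simp [g1], by simp, by simp [g2], by simp, by simp [g4], by simp [g5],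
            fun a b h => ?_⟩
          simp [show a ≠ 8 by omega, g6 a b h]
      · exact le_rfl
      · rintro m' ⟨-, h1, h2, h3⟩; exact ⟨h1, h2, h3⟩
    rintro m3 ⟨g1, g2, g3, g4, g5⟩
    refine Reaches.of_loopFree trivial (by decide) ?_
    refine ⟨by simp [g1], by simp, fun j hj => ?_, fun hinj j hj => ?_, by simp [g4],
      fun a b h => ?_⟩
    · simp [g3, k2 j hj]
    · rcases Nat.lt_or_ge j i with hji | hji
      · have : rank d v j ≠ rank d v i := fun h =>
          hji.ne (hinj (show j < d by omega) hi h)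
        simp [g1, g2, this, g3, k3 hinj j hji]
      · obtain rfl : j = i := by omega
        simp [g1, g2, g3, k2 j hi]
    · simp [show a ≠ 7 by omega, g5 a b h]
  · exact le_rfl
  · rintro m' ⟨-, -, h⟩; exact h

open scoped Classical in
/-- The sign that the random real `u` selects. -/
def signOf (u : ℝ) : ℝ := if u + u < 1 then 0 - 1 else 1

/-- Writes `d` random signs to the real row `2`. -/
def signProgram : Program :=
  forLoop 7 (iat 0 0) <| .seq (.draw 5 (ivar 7)) <|
    .ite (.realLt (rat 5 (ivar 7) + rat 5 (ivar 7)) (1 : IExpr))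
      (.setReal 2 (ivar 7) ((0 : IExpr) - (1 : IExpr))) (.setReal 2 (ivar 7) (1 : IExpr))

theorem reaches_signProgram (ω : ℕ → unitInterval) (m : Memory) {d a : ℕ} (hd : 1 ≤ d)
    (hmd : m.int 0 0 = d) (hm : m.drawn = a) :
    Reaches ω signProgram (200 * d) (fun m' => (∀ i < d, m'.real 2 i = signOf (ω (a + i))) ∧
      (∀ b, m'.real 1 b = m.real 1 b) ∧ ∀ a b, a < 7 → m'.int a b = m.int a b) m := by
  classical
  refine (Reaches.forLoop (N := d) (T := 100) (fun i m' => m'.int 7 0 = i ∧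
      m'.drawn = a + i ∧ (∀ j < i, m'.real 2 j = signOf (ω (a + j))) ∧
      (∀ b, m'.real 1 b = m.real 1 b) ∧ ∀ a b, a < 7 → m'.int a b = m.int a b)
      ?_ ?_ ?_ ?_).mono ?_ ?_
  · refine ⟨by simp, by simp [hm], by simp, by simp, fun a b h => ?_⟩
    simp [show a ≠ 7 by omega]
  · exact fun i m' h => h.1
  · rintro i m' ⟨-, -, -, -, h⟩; simp [h, hmd]
  · rintro i m1 hi ⟨h1, h2, h3, h4, h5⟩
    refine Reaches.of_loopFree (by simp [Program.LoopFree]) (by decide) ?_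
    have ex : (Program.seq (.draw 5 (ivar 7)) <|
        .ite (.realLt (rat 5 (ivar 7) + rat 5 (ivar 7)) (1 : IExpr))
          (.setReal 2 (ivar 7) ((0 : IExpr) - (1 : IExpr)))
          (.setReal 2 (ivar 7) (1 : IExpr))).exec ω m1 =
        (m1.drawReal ω 5 i).writeReal 2 i (signOf (ω (a + i))) := by
      by_cases c : (ω (a + i) : ℝ) + ω (a + i) < 1 <;> simp [h1, h2, c, signOf]
    rw [ex]
    refine ⟨by simp [h1], by simp, by simp [h2, add_assoc], fun j hj => ?_, by simp [h4],
      fun a b h => ?_⟩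
    · by_cases hji : j = i
      · simp [hji]
      · simp [hji, h3 j (by omega)]
    · simp [show a ≠ 7 by omega, h5 a b h]
  · simp only [iat, IExpr.cost]
    omega
  · rintro m' ⟨-, -, h⟩; exact h

/-- Writes the output to the real row `0`. -/
def outputProgram : Program :=
  forLoop 7 (iat 0 0) <|
    .seq (.ite (.intEq (ivar 7) 0) (.setReal 4 0 (0 : IExpr))
      (.setReal 4 0 (rat 1 (iat 2 (ivar 7 - 1))))) <|
    .seq (.setReal 4 1 (rat 4 0 - rat 1 (iat 2 (ivar 7)))) <|
    .seq (.ite (.realLt (rat 4 0) (rat 1 (iat 2 (ivar 7))))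
      (.setReal 4 1 (rat 4 1 + (1 : IExpr))) .skip) <|
    .setReal 0 (ivar 7) (rat 2 (ivar 7) * rat 4 1)

theorem reaches_outputProgram (ω : ℕ → unitInterval) (m : Memory) {d : ℕ} (hd : 1 ≤ d)
    (hmd : m.int 0 0 = d) :
    Reaches ω outputProgram (300 * d) (fun m' =>
      (∀ i : Fin d, m'.real 0 i =
        m.real 2 i * stanley (fun l : Fin d => m.real 1 (m.int 2 l)) i) ∧
      (∀ b, m'.real 1 b = m.real 1 b) ∧ (∀ b, m'.real 2 b = m.real 2 b) ∧
      ∀ a b, a < 7 → m'.int a b = m.int a b) m := by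
  classical
  refine (Reaches.forLoop (N := d) (T := 200) (fun i m' => m'.int 7 0 = i ∧
      (∀ j : Fin d, (j : ℕ) < i → m'.real 0 j =
        m.real 2 j * stanley (fun l : Fin d => m.real 1 (m.int 2 l)) j) ∧
      (∀ b, m'.real 1 b = m.real 1 b) ∧ (∀ b, m'.real 2 b = m.real 2 b) ∧
      ∀ a b, a < 7 → m'.int a b = m.int a b)
      ?_ ?_ ?_ ?_).mono ?_ ?_
  · refine ⟨by simp, by simp, by simp, by simp, fun a b h => ?_⟩
    simp [show a ≠ 7 by omega]
  · exact fun i m' h => h.1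
  · rintro i m' ⟨-, -, -, -, h⟩; simp [h, hmd]
  · rintro i m1 hi ⟨h1, h2, h3, h4, h5⟩
    refine Reaches.of_loopFree (by simp [Program.LoopFree]) (by decide) ?_
    have h20 : ∀ b, m1.int 2 b = m.int 2 b := fun b => h5 2 b (by omega)
    -- Only the output cell matters; the values `p` and `c` left in scratch memory are forgotten.
    obtain ⟨p, c, ex⟩ : ∃ p c, (Program.seq (.ite (.intEq (ivar 7) 0) (.setReal 4 0 (0 : IExpr))
          (.setReal 4 0 (rat 1 (iat 2 (ivar 7 - 1))))) <|
        .seq (.setReal 4 1 (rat 4 0 - rat 1 (iat 2 (ivar 7)))) <|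
        .seq (.ite (.realLt (rat 4 0) (rat 1 (iat 2 (ivar 7))))
          (.setReal 4 1 (rat 4 1 + (1 : IExpr))) .skip) <|
        .setReal 0 (ivar 7) (rat 2 (ivar 7) * rat 4 1)).exec ω m1 =
        ((m1.writeReal 4 0 p).writeReal 4 1 c).writeReal 0 i
          (m.real 2 i * stanley (fun l : Fin d => m.real 1 (m.int 2 l)) ⟨i, hi⟩) := by
      set x : Fin d → ℝ := fun l => m.real 1 (m.int 2 l) with hx
      have hcur : m1.real 1 (m1.int 2 i) = x ⟨i, hi⟩ := by rw [h20, h3]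
      have hprev : (if i = 0 then 0 else m1.real 1 (m1.int 2 (i - 1))) = prevCoord x ⟨i, hi⟩ := by
        rw [h20, h3]; rfl
      refine ⟨prevCoord x ⟨i, hi⟩, stanley x ⟨i, hi⟩, ?_⟩
      have e1 : (Program.ite (.intEq (ivar 7) 0) (.setReal 4 0 (0 : IExpr))
          (.setReal 4 0 (rat 1 (iat 2 (ivar 7 - 1))))).exec ω m1 =
          m1.writeReal 4 0 (prevCoord x ⟨i, hi⟩) := by
        rw [← hprev]
        by_cases c : i = 0 <;> simp [h1, c]
      rw [Program.exec, e1]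
      unfold stanley
      by_cases c : prevCoord x ⟨i, hi⟩ < x ⟨i, hi⟩
      · simp [h1, h4, hcur, c]
      · simp [h1, h4, hcur, c]
    rw [ex]
    refine ⟨by simp [h1], by simp, fun j hj => ?_, by simp [h3], by simp [h4],
      fun a b h => ?_⟩
    · by_cases hji : (j : ℕ) = i
      · obtain rfl : j = ⟨i, hi⟩ := Fin.ext hji
        simp
      · simp [hji, h2 j (by omega)]
    · simp [show a ≠ 7 by omega, h5 a b h]
  · simp only [iat, IExpr.cost]
    omega
  · rintro m' ⟨-, h1, h2⟩; exact ⟨fun i => h1 i i.2, h2⟩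

/-! ### The sampling program -/

/-- The sampling program. -/
def sampler : Program :=
  .seq tableProgram <| .seq levelProgram <| .seq wordProgram <| .seq simplexProgram <|
    .seq signProgram outputProgram

/-- Draws are consumed in fixed blocks: 0 for the slice, `1, …, d` for the run counts, `d + 1, …,
2d` for the insertions, `2d + 1, …, 3d` for the simplex point and `3d + 1, …, 4d` for the signs. -/
theorem reaches_sampler (ω : ℕ → unitInterval) {d k : ℕ} (hd : 1 ≤ d) (hk : 1 ≤ k) :
    Reaches ω sampler (10000 * d ^ 2) (fun m =>
      m.int 1 0 = level d k (fun l => ω l) 0 ∧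
      (∀ i < d, m.int 2 i = word d k (fun l => ω l) d i) ∧
      (Set.InjOn (rank d fun l => ω (2 * d + 1 + l)) (Set.Iio d) →
        ∀ i < d, m.real 1 (rank d (fun l => ω (2 * d + 1 + l)) i) = ω (2 * d + 1 + i)) ∧
      (∀ i < d, m.real 2 i = signOf (ω (3 * d + 1 + i))) ∧
      ∀ i : Fin d, m.real 0 i =
        m.real 2 i * stanley (fun l : Fin d => m.real 1 (m.int 2 l)) i) (Memory.init d k) := by
  have hdd : d ≤ d ^ 2 := by nlinarith
  have i0 : (Memory.init d k).int 0 0 = d := by simp [Memory.init]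
  have i1 : (Memory.init d k).int 0 1 = k := by simp [Memory.init]
  refine Reaches.le (T := 1 + 1000 * d ^ 2 + (1 + 2000 * d + (1 + 2000 * d ^ 2 +
    (1 + 1000 * d ^ 2 + (1 + 200 * d + 300 * d))))) ?_ (by nlinarith)
  refine Reaches.seq ((reaches_tableProgram ω _ (by rw [i0]; exact hd)
    (fun j => rfl)).le (by rw [i0])) ?_
  rintro m1 ⟨a1, a2, a3, -⟩
  rw [i0] at a1
  refine Reaches.seq (reaches_levelProgram ω m1 hd hk (by rw [a3 _ _ (by simp) (by simp), i0])
    (by rw [a3 _ _ (by simp) (by simp), i1]) a2 a1) ?_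
  rintro m2 ⟨b1, b2, b3, b4, -⟩
  refine Reaches.seq (reaches_wordProgram ω m2 hd (by rw [b4, a3 _ _ (by simp) (by simp), i0])
    b3 b1) ?_
  rintro m3 ⟨c1, c2, c3, c4⟩
  refine Reaches.seq (reaches_simplexProgram ω m3 hd c3 c2) ?_
  rintro m4 ⟨e1, e2, e3⟩
  refine Reaches.seq (reaches_signProgram ω m4 (a := 3 * d + 1) hd (by rw [e3 _ _ (by simp), c3])
    (by omega)) ?_
  rintro m5 ⟨f1, f2, f3⟩
  refine (reaches_outputProgram ω m5 hd
    (by rw [f3 _ _ (by simp), e3 _ _ (by simp), c3])).mono le_rfl ?_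
  rintro m6 ⟨g1, g2, g3, g4⟩
  have h2 : ∀ b, m6.int 2 b = m5.int 2 b := fun b => g4 _ _ (by simp)
  refine ⟨?_, fun i hi => ?_, fun h i hi => ?_, fun i hi => ?_, fun i => ?_⟩
  · rw [g4 _ _ (by simp), f3 _ _ (by simp), e3 _ _ (by simp), c4, b2]
  · rw [g4 _ _ (by simp), f3 _ _ (by simp), e3 _ _ (by simp), c1 i hi]
  · rw [g2, f2, e1 h i hi]
  · rw [g3, f1 i hi]
  · simp only [g1, g2, g3, h2]

/-! ### Ascents, insertion of the maximum, and Eulerian numbers -/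

theorem ascents_succ {n : ℕ} {α : Type*} [LinearOrder α] (f : Fin (n + 1) → α) :
    ascents f = ∑ i : Fin n, if f i.castSucc < f i.succ then 1 else 0 := by
  classical
  unfold ascents
  rw [Set.ncard_eq_toFinset_card', ← Finset.card_filter]
  symm
  refine Finset.card_bij (fun i _ => i.castSucc) ?_ (fun i _ j _ h => Fin.castSucc_injective _ h) ?_
  · intro i hi
    simp only [Finset.mem_filter, Finset.mem_univ, true_and] at hi
    simp only [Set.mem_toFinset, Set.mem_ofPred_eq]
    exact ⟨by simp, hi⟩
  · intro i hi
    simp only [Set.mem_toFinset, Set.mem_ofPred_eq] at hi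
    obtain ⟨h, hi⟩ := hi
    refine ⟨⟨i, by omega⟩, ?_, rfl⟩
    simp only [Finset.mem_filter, Finset.mem_univ, true_and]
    exact hi

/-- The number of ascents of `w 0, …, w (n - 1)`. -/
def ascentCount (n : ℕ) (w : ℕ → ℕ) : ℕ :=
  ∑ i ∈ Finset.range (n - 1), if w i < w (i + 1) then 1 else 0

/-- The sequence of values of a permutation. -/
def permWord {n : ℕ} (σ : Equiv.Perm (Fin n)) (i : ℕ) : ℕ := if h : i < n then σ ⟨i, h⟩ else 0

theorem permWord_val {n : ℕ} (σ : Equiv.Perm (Fin n)) (i : Fin n) : permWord σ i = σ i := by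
  simp [permWord]

theorem permWord_lt {n : ℕ} (σ : Equiv.Perm (Fin n)) {i : ℕ} (hi : i < n) : permWord σ i < n := by
  simp [permWord, hi]

theorem ascents_perm {n : ℕ} (σ : Equiv.Perm (Fin n)) :
    ascents (σ : Fin n → Fin n) = ascentCount n (permWord σ) := by
  cases n with
  | zero => simp [ascents, ascentCount]
  | succ n =>
    rw [ascents_succ, ascentCount, Nat.add_sub_cancel, ← Fin.sum_univ_eq_sum_range
      (fun i => if permWord σ i < permWord σ (i + 1) then 1 else 0)]
    refine Finset.sum_congr rfl fun i _ => ?_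
    have h1 : permWord σ (i : ℕ) = σ i.castSucc := permWord_val σ i.castSucc
    have h2 : permWord σ (i + 1 : ℕ) = σ i.succ := permWord_val σ i.succ
    rw [h1, h2]
    rfl

-- The gaps that keep the count are the one in front and the one inside each ascent.
open scoped Classical in
theorem sum_keepsRuns (n : ℕ) (w : ℕ → ℕ) :
    (∑ p ∈ Finset.range (n + 1), if KeepsRuns n w p then 1 else 0) = ascentCount n w + 1 := by
  cases n with
  | zero => simp [KeepsRuns, ascentCount]
  | succ n =>
    rw [Finset.sum_range_succ', Finset.sum_range_succ, ascentCount, Nat.add_sub_cancel]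
    simp only [KeepsRuns, true_or, if_true, lt_irrefl, false_and, or_false, Nat.add_one_ne_zero,
      if_false, add_zero, false_or]
    congr 1
    refine Finset.sum_congr rfl fun i hi => ?_
    have : i + 1 < n + 1 := by have := Finset.mem_range.1 hi; omega
    simp [this]

-- A maximum creates an ascent with its left neighbour, if there is one, and none with its right
-- neighbour; it also separates the two neighbours. So the count is unchanged exactly in front or
-- inside an existing ascent.
open scoped Classical in
theorem ascentCount_insertMax {n p : ℕ} {w : ℕ → ℕ} (hp : p ≤ n) (hw : ∀ i < n, w i < n) :
    ascentCount (n + 1) (insertMax n p w) =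
      ascentCount n w + if KeepsRuns n w p then 0 else 1 := by
  have hlo : ∀ i < p, insertMax n p w i = w i := fun i hi => by simp [insertMax, hi]
  have hmid : insertMax n p w p = n := by simp [insertMax]
  have hhi : ∀ i, p < i → insertMax n p w i = w (i - 1) := fun i hi => by
    simp [insertMax, hi.not_gt, hi.ne']
  unfold ascentCount
  rw [Nat.add_sub_cancel]
  rcases p with _ | q
  · rcases n with _ | n
    · simp [KeepsRuns]
    · have h0 : ¬ n + 1 < w 0 := (hw 0 (by omega)).not_gt
      rw [Finset.sum_range_succ', hmid, hhi (0 + 1) (by omega)]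
      simp only [zero_add, Nat.sub_self, h0, if_false, add_zero, KeepsRuns, true_or, if_true,
        Nat.add_sub_cancel]
      refine Finset.sum_congr rfl fun i _ => ?_
      rw [hhi (i + 1) (by omega), hhi (i + 1 + 1) (by omega)]
      simp
  · obtain ⟨r, rfl⟩ := Nat.exists_eq_add_of_le hp
    have e1 : ∑ i ∈ Finset.range q, (if insertMax (q + 1 + r) (q + 1) w i <
        insertMax (q + 1 + r) (q + 1) w (i + 1) then 1 else 0) =
        ∑ i ∈ Finset.range q, if w i < w (i + 1) then 1 else 0 := by
      refine Finset.sum_congr rfl fun i hi => ?_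
      have := Finset.mem_range.1 hi
      rw [hlo i (by omega), hlo (i + 1) (by omega)]
    have e2 : w q < q + 1 + r := hw q (by omega)
    rw [Finset.sum_range_add, Finset.sum_range_succ, e1, hlo q (by omega), hmid, if_pos e2]
    -- For `r = 0` the maximum goes to the end: an ascent is gained and no comparison is lost.
    rcases r with _ | r
    · simp [KeepsRuns]
    · have e3 : ¬ q + 1 + (r + 1) < w (q + 1) := (hw _ (by omega)).not_gt
      rw [Finset.sum_range_succ', show q + 1 + (r + 1) - 1 = q + 1 + r by omega,
        Finset.sum_range_add, Finset.sum_range_succ, add_zero, hmid, hhi (q + 1 + 1) (by omega),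
        Nat.add_sub_cancel, if_neg e3, add_zero]
      have e4 : ∑ i ∈ Finset.range r, (if insertMax (q + 1 + (r + 1)) (q + 1) w (q + 1 + (i + 1)) <
          insertMax (q + 1 + (r + 1)) (q + 1) w (q + 1 + (i + 1) + 1) then 1 else 0) =
          ∑ i ∈ Finset.range r, if w (q + 1 + i) < w (q + 1 + i + 1) then 1 else 0 := by
        refine Finset.sum_congr rfl fun i _ => ?_
        rw [hhi _ (by omega), hhi _ (by omega)]
        rfl
      rw [e4]
      have e5 : KeepsRuns (q + 1 + (r + 1)) w (q + 1) ↔ w q < w (q + 1) := by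
        simp only [KeepsRuns, Nat.add_one_ne_zero, false_or, Nat.add_sub_cancel]
        exact ⟨fun h => h.2, fun h => ⟨by omega, h⟩⟩
      simp only [e5]
      split_ifs <;> omega

/-- The permutation of `n + 1` elements that arises from `σ` by inserting the maximum before
position `p`. -/
def insertPerm {n : ℕ} (p : Fin (n + 1)) (σ : Equiv.Perm (Fin n)) : Equiv.Perm (Fin (n + 1)) :=
  (finSuccEquiv' p).trans ((Equiv.optionCongr σ).trans (finSuccEquiv' (Fin.last n)).symm)

theorem insertPerm_self {n : ℕ} (p : Fin (n + 1)) (σ : Equiv.Perm (Fin n)) :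
    insertPerm p σ p = Fin.last n := by
  simp [insertPerm]

theorem insertPerm_succAbove {n : ℕ} (p : Fin (n + 1)) (σ : Equiv.Perm (Fin n)) (i : Fin n) :
    insertPerm p σ (p.succAbove i) = (σ i).castSucc := by
  simp [insertPerm]

/-- The maximum marks the insertion position, and deleting it returns the old permutation.
Injectivity and `(n + 1) * n! = (n + 1)!` suffice. -/
theorem insertPerm_bijective (n : ℕ) :
    Function.Bijective fun c : Fin (n + 1) × Equiv.Perm (Fin n) => insertPerm c.1 c.2 := by
  rw [Fintype.bijective_iff_injective_and_card]
  constructor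
  · rintro ⟨p, σ⟩ ⟨q, τ⟩ h
    simp only at h
    obtain rfl : p = q := by
      apply (insertPerm p σ).injective
      rw [insertPerm_self, h, insertPerm_self]
    congr 1
    ext i
    have := insertPerm_succAbove p σ i
    rw [h, insertPerm_succAbove] at this
    exact congrArg Fin.val (Fin.castSucc_injective _ this.symm)
  · simp [Fintype.card_perm, Nat.factorial_succ]

theorem permWord_insertPerm {n : ℕ} (p : Fin (n + 1)) (σ : Equiv.Perm (Fin n)) {i : ℕ}
    (hi : i < n + 1) : permWord (insertPerm p σ) i = insertMax n p (permWord σ) i := by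
  obtain h | ⟨l, h⟩ := Fin.eq_self_or_eq_succAbove p ⟨i, hi⟩
  · obtain rfl : i = p := congrArg Fin.val h
    simp [permWord_val, insertPerm_self, insertMax]
  · have e : permWord (insertPerm p σ) i = σ l := by
      rw [show i = ((⟨i, hi⟩ : Fin (n + 1)) : ℕ) from rfl, permWord_val, h, insertPerm_succAbove]
      rfl
    have hv : i = (p.succAbove l : Fin (n + 1)) := congrArg Fin.val h
    rw [e, ← permWord_val]
    unfold insertMax
    rw [Fin.succAbove] at hv
    split_ifs at hv with c
    · have c' : (l : ℕ) < p := c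
      rw [Fin.val_castSucc] at hv
      rw [hv, if_pos c']
    · have c' : ¬ (l : ℕ) < p := c
      rw [Fin.val_succ] at hv
      rw [hv, if_neg (by omega), if_neg (by omega), Nat.add_sub_cancel]

theorem ascentCount_congr {n : ℕ} {w w' : ℕ → ℕ} (h : ∀ i < n, w i = w' i) :
    ascentCount n w = ascentCount n w' := by
  refine Finset.sum_congr rfl fun i hi => ?_
  have := Finset.mem_range.1 hi
  rw [h i (by omega), h (i + 1) (by omega)]

open scoped Classical in
theorem ascents_insertPerm {n : ℕ} (p : Fin (n + 1)) (σ : Equiv.Perm (Fin n)) :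
    ascents (insertPerm p σ) = ascents σ + if KeepsRuns n (permWord σ) p then 0 else 1 := by
  rw [ascents_perm, ascents_perm, ascentCount_congr fun i hi => permWord_insertPerm p σ hi,
    ascentCount_insertMax (Nat.lt_succ_iff.1 p.2) fun i hi => permWord_lt σ hi]

-- The Eulerian recursion: each permutation of `n` elements contributes through its keeping gaps or
-- its raising gaps. Runs are counted here by `ascents + 1`, which gives the empty permutation one
-- run.
open scoped Classical in
theorem runNumber_eq_card (n j : ℕ) :
    runNumber n j = ∑ σ : Equiv.Perm (Fin n), if ascents σ + 1 = j then 1 else 0 := by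
  induction n generalizing j with
  | zero =>
    have : ∀ σ : Equiv.Perm (Fin 0), ascents (σ : Fin 0 → Fin 0) = 0 := fun σ => by
      simp [ascents]
    simp [runNumber, this, eq_comm]
  | succ n ih =>
    rw [← Equiv.sum_comp (Equiv.ofBijective _ (insertPerm_bijective n)), Fintype.sum_prod_type_right,
      runNumber, ih, ih, Finset.mul_sum, Finset.mul_sum, ← Finset.sum_add_distrib]
    refine Finset.sum_congr rfl fun σ _ => ?_
    simp only [Equiv.ofBijective_apply, ascents_insertPerm]
    have hk : (∑ p : Fin (n + 1), if KeepsRuns n (permWord σ) p then 1 else 0) = ascents σ + 1 := by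
      rw [Fin.sum_univ_eq_sum_range (fun p => if KeepsRuns n (permWord σ) p then 1 else 0),
        sum_keepsRuns, ascents_perm]
    have hk' : (∑ p : Fin (n + 1), if KeepsRuns n (permWord σ) p then 0 else 1) +
        (ascents σ + 1) = n + 1 := by
      rw [← hk, ← Finset.sum_add_distrib]
      rw [Finset.sum_congr rfl (g := fun _ => 1) fun p _ => by split_ifs <;> rfl]
      simp
    by_cases h1 : ascents σ + 1 = j
    · rw [Finset.sum_congr rfl (g := fun p : Fin (n + 1) =>
        if KeepsRuns n (permWord σ) p then 1 else 0) fun p _ => by split_ifs <;> omega, hk]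
      rw [if_pos h1, if_neg (by omega)]
      omega
    · by_cases h2 : ascents σ + 2 = j
      · rw [Finset.sum_congr rfl (g := fun p : Fin (n + 1) =>
          if KeepsRuns n (permWord σ) p then 0 else 1) fun p _ => by split_ifs <;> omega]
        rw [if_neg h1, if_pos (by omega)]
        omega
      · rw [Finset.sum_eq_zero fun p _ => by split_ifs <;> omega, if_neg h1, if_neg (by omega)]
        simp

theorem runNumber_succ_eq_eulerian (n j : ℕ) : runNumber n (j + 1) = eulerian n j := by
  classical
  rw [runNumber_eq_card, eulerian, permsWithAscents, Set.ncard_eq_toFinset_card',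
    ← Finset.card_filter]
  congr 1
  ext σ
  simp

/-! ### The law of the sampled permutation -/

theorem pick_eq {n i : ℕ} {w : ℕ → ℝ} {u : ℝ} (hw : ∀ l, 0 ≤ w l) (hi : i < n)
    (h1 : ∑ l ∈ Finset.range i, w l ≤ u * ∑ l ∈ Finset.range n, w l)
    (h2 : u * ∑ l ∈ Finset.range n, w l < ∑ l ∈ Finset.range (i + 1), w l) : pick n w u = i := by
  classical
  have mono : ∀ a b, a ≤ b → ∑ l ∈ Finset.range a, w l ≤ ∑ l ∈ Finset.range b, w l := fun a b h =>
    Finset.sum_le_sum_of_subset_of_nonneg (Finset.range_mono h) fun l _ _ => hw l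
  unfold pick
  rw [← Finset.card_filter]
  have : ((Finset.range (n - 1)).filter fun i => ∑ l ∈ Finset.range (i + 1), w l ≤
      u * ∑ l ∈ Finset.range n, w l) = Finset.range i := by
    ext l
    simp only [Finset.mem_filter, Finset.mem_range]
    constructor
    · rintro ⟨_, h⟩
      by_contra hl
      exact absurd (h.trans_lt h2) (mono _ _ (by omega)).not_gt
    · intro hl
      exact ⟨by omega, (mono _ _ (by omega)).trans h1⟩
  rw [this, Finset.card_range]

/-- The half-open interval between consecutive normalized partial sums forces the index. That it has
the right length is enough; the exact preimage of the index is never needed. -/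
theorem exists_set_pick {n i : ℕ} {w : ℕ → ℝ} (hw : ∀ l, 0 ≤ w l) (hi : i < n)
    (hpos : 0 < ∑ l ∈ Finset.range n, w l) :
    ∃ A : Set unitInterval, MeasurableSet A ∧
      volume A = ENNReal.ofReal (w i / ∑ l ∈ Finset.range n, w l) ∧
      ∀ u ∈ A, pick n w u = i := by
  set W := ∑ l ∈ Finset.range n, w l with hW
  set a := (∑ l ∈ Finset.range i, w l) / W with ha
  set b := (∑ l ∈ Finset.range (i + 1), w l) / W with hb
  have ha0 : 0 ≤ a := div_nonneg (Finset.sum_nonneg fun l _ => hw l) hpos.le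
  have hb1 : b ≤ 1 := by
    rw [hb, div_le_one hpos]
    exact Finset.sum_le_sum_of_subset_of_nonneg (Finset.range_mono hi) fun l _ _ => hw l
  refine ⟨Subtype.val ⁻¹' Set.Ico a b, measurable_subtype_coe measurableSet_Ico, ?_, ?_⟩
  · have h1 : Set.Ico a b ⊆ unitInterval := fun x hx => ⟨ha0.trans hx.1, hx.2.le.trans hb1⟩
    rw [unitInterval.volume_apply, Subtype.image_preimage_coe, Set.inter_eq_right.2 h1,
      Real.volume_Ico]
    congr 1
    rw [hb, ha, ← sub_div, Finset.sum_range_succ, add_sub_cancel_left]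
  · rintro u ⟨h1, h2⟩
    exact pick_eq hw hi ((div_le_iff₀ hpos).1 h1) ((lt_div_iff₀ hpos).1 h2)

theorem runNumber_ascents_pos {n : ℕ} (σ : Equiv.Perm (Fin n)) :
    0 < runNumber n (ascents σ + 1) := by
  classical
  rw [runNumber_eq_card]
  exact Finset.sum_pos' (fun _ _ => Nat.zero_le _) ⟨σ, Finset.mem_univ _, by simp⟩

theorem ascents_le {n : ℕ} (σ : Equiv.Perm (Fin n)) : ascents σ ≤ n := by
  rw [ascents_perm, ascentCount, ← Finset.card_filter]
  exact (Finset.card_filter_le _ _).trans (by simp)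

theorem ascents_lt {n : ℕ} (hn : 1 ≤ n) (σ : Equiv.Perm (Fin n)) : ascents σ < n := by
  rw [ascents_perm, ascentCount, ← Finset.card_filter]
  exact (Finset.card_filter_le _ _).trans_lt (by simp; omega)

theorem sum_runWeights (n j : ℕ) : ∑ i ∈ Finset.range 2, runWeights n j i = runNumber (n + 1) j := by
  simp [Finset.sum_range_succ, runWeights, runNumber]

theorem gapWeights_congr {n : ℕ} {w w' : ℕ → ℕ} (h : ∀ i < n, w i = w' i) {P Q : Prop}
    (hPQ : P ↔ Q) (p : ℕ) : gapWeights n w P p = gapWeights n w' Q p := by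
  have : KeepsRuns n w p ↔ KeepsRuns n w' p := by
    unfold KeepsRuns
    refine or_congr_right (and_congr_right fun hp => ?_)
    rw [h p hp, h (p - 1) (by omega)]
  classical
  exact if_congr (iff_congr this hPQ) rfl rfl

open scoped Classical in
theorem sum_gapWeights {n : ℕ} (w : ℕ → ℕ) (P : Prop) (hw : ascentCount n w ≤ n) :
    ∑ p ∈ Finset.range (n + 1), gapWeights n w P p =
      if P then (ascentCount n w + 1 : ℝ) else ((n - ascentCount n w : ℕ) : ℝ) := by
  have h := sum_keepsRuns n w
  have h' : (∑ p ∈ Finset.range (n + 1), if KeepsRuns n w p then 0 else 1) =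
      n - ascentCount n w := by
    have : (∑ p ∈ Finset.range (n + 1), if KeepsRuns n w p then 0 else 1) +
        (ascentCount n w + 1) = n + 1 := by
      rw [← h, ← Finset.sum_add_distrib,
        Finset.sum_congr rfl (g := fun _ => 1) fun p _ => by split_ifs <;> rfl]
      simp
    omega
  unfold gapWeights
  by_cases hP : P
  · simp only [hP, iff_true, if_true]
    exact_mod_cast congrArg (Nat.cast (R := ℝ)) h
  · simp only [hP, iff_false, if_false]
    rw [← h', Nat.cast_sum]
    refine Finset.sum_congr rfl fun p _ => ?_
    by_cases hk : KeepsRuns n w p <;> simp [hk]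

/-- Given the number of runs, the draws that produce a prescribed permutation contain a box. -/
theorem exists_box_word {d : ℕ} (k : ℕ) {n : ℕ} (hn : n ≤ d) (σ : Equiv.Perm (Fin n)) :
    ∃ A : ℕ → Set unitInterval, (∀ i, MeasurableSet (A i)) ∧
      ∏ i ∈ Finset.Ico (d - n + 1) (d + n + 1), volume (A i) =
        ENNReal.ofReal (1 / runNumber n (ascents σ + 1)) ∧
      ∀ u : ℕ → unitInterval, (∀ i ∈ Finset.Ico (d - n + 1) (d + n + 1), u i ∈ A i) →
        level d k (fun l => u l) (d - n) = ascents σ + 1 →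
        ∀ i < n, word d k (fun l => u l) n i = permWord σ i := by
  classical
  induction n with
  | zero =>
    refine ⟨fun _ => Set.univ, fun _ => MeasurableSet.univ, ?_, fun _ _ _ i hi => by omega⟩
    have : ascents (σ : Fin 0 → Fin 0) = 0 := by simp [ascents]
    simp [runNumber, this]
  | succ n ih =>
    obtain ⟨⟨p, τ⟩, rfl⟩ := (insertPerm_bijective n).2 σ
    obtain ⟨A, hA, hvol, hword⟩ := ih (by omega) τ
    simp only at *
    set J := ascents τ + 1 with hJ
    set J' := ascents (insertPerm p τ) + 1 with hJ'
    set keep := KeepsRuns n (permWord τ) p with hkeep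
    have hJJ : J' = J + if keep then 0 else 1 := by
      rw [hJ', ascents_insertPerm]
      change ascents τ + (if keep then 0 else 1) + 1 = _
      omega
    have hJn : ascents τ ≤ n := ascents_le τ
    have hR : (0 : ℝ) < runNumber n J := by exact_mod_cast runNumber_ascents_pos τ
    have hR' : (0 : ℝ) < runNumber (n + 1) J' := by
      exact_mod_cast runNumber_ascents_pos (insertPerm p τ)
    -- the number of gaps of the same kind
    set g : ℝ := if keep then (ascents τ + 1 : ℝ) else ((n - ascents τ : ℕ) : ℝ) with hg
    have hsum : ∑ q ∈ Finset.range (n + 1), gapWeights n (permWord τ) keep q = g := by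
      rw [sum_gapWeights _ _ (by rw [← ascents_perm]; exact hJn), ← ascents_perm]
    have hgap0 : ∀ q, 0 ≤ gapWeights n (permWord τ) keep q := fun q => by
      unfold gapWeights; split_ifs <;> simp
    have hgapp : gapWeights n (permWord τ) keep p = 1 := by simp [gapWeights, hkeep]
    have hg0 : 0 < g := by
      rw [← hsum]
      exact Finset.sum_pos' (fun q _ => hgap0 q)
        ⟨p, Finset.mem_range.2 p.2, by rw [hgapp]; exact one_pos⟩
    obtain ⟨B, hB, hBvol, hBpick⟩ := exists_set_pick hgap0 p.2 (by rw [hsum]; exact hg0)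
    rw [hsum, hgapp] at hBvol
    have hw0 : ∀ l, 0 ≤ runWeights n J' l := fun l => by
      unfold runWeights; split_ifs <;> positivity
    obtain ⟨E, hE, hEvol, hEpick⟩ := exists_set_pick (i := if keep then 0 else 1) hw0
      (show _ < 2 by split_ifs <;> simp) (by rw [sum_runWeights]; exact hR')
    -- The weight of the required term of the recursion contains the number `g` of suitable gaps,
    -- which cancels against the probability `1 / g` of the prescribed gap.
    have hEw : runWeights n J' (if keep then 0 else 1) = g * runNumber n J := by
      by_cases hk : keep
      · simp [hk, hg, runWeights, hJJ, hJ]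
      · have : n + 2 - (ascents τ + 1 + 1) = n - ascents τ := by omega
        simp [hk, hg, runWeights, hJJ, hJ, this]
    rw [sum_runWeights, hEw] at hEvol
    -- Draw `d - n` decides the run count on the way down from size `n + 1` to size `n`, and draw `d
    -- + n + 1` the gap on the way up. The interval of used draws grows by one at either end.
    refine ⟨fun i => if i = d - n then E else if i = d + n + 1 then B else A i, fun i => ?_, ?_, ?_⟩ <;> beta_reduce
    · split_ifs
      exacts [hE, hB, hA i]
    · have hI : Finset.Ico (d - (n + 1) + 1) (d + (n + 1) + 1) =
          insert (d - n) (insert (d + n + 1) (Finset.Ico (d - n + 1) (d + n + 1))) := by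
        ext i
        simp only [Finset.mem_insert, Finset.mem_Ico]
        omega
      rw [hI, Finset.prod_insert, Finset.prod_insert]
      · rw [Finset.prod_congr rfl (g := fun i => volume (A i)), hvol, if_pos rfl, if_neg (by omega),
          if_pos rfl, hEvol, hBvol, ← ENNReal.ofReal_mul (by positivity),
          ← ENNReal.ofReal_mul (by positivity)]
        · congr 1
          field_simp
        · intro i hi
          have := Finset.mem_Ico.1 hi
          rw [if_neg (by omega), if_neg (by omega)]
      · simp
      · simp only [Finset.mem_insert, Finset.mem_Ico]
        omega
    · intro u hu hlev i hi
      have hlev' : level d k (fun l => u l) (d - n) = J := by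
        have e : d - n = d - (n + 1) + 1 := by omega
        have hm := hu (d - n) (Finset.mem_Ico.2 ⟨by omega, by omega⟩)
        rw [if_pos rfl] at hm
        have hp := hEpick _ hm
        rw [e, level, hlev, show d - (d - (n + 1)) - 1 = n by omega, ← e, hp, hJJ]
        split_ifs <;> omega
      have hw := hword u (fun i hi => by
        have hi' := Finset.mem_Ico.1 hi
        have := hu i (Finset.mem_Ico.2 ⟨by omega, by omega⟩)
        rwa [if_neg (by omega), if_neg (by omega)] at this) hlev'
      have hkk : (level d k (fun l => (u l : ℝ)) (d - n) =
          level d k (fun l => (u l : ℝ)) (d - (n + 1))) ↔ keep := by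
        rw [hlev, hlev', hJJ]
        by_cases hk : keep <;> simp [hk]
      have hm := hu (d + 1 + n) (Finset.mem_Ico.2 ⟨by omega, by omega⟩)
      rw [if_neg (by omega), if_pos (by omega)] at hm
      have hp := hBpick _ hm
      rw [permWord_insertPerm p τ hi, word, pick_congr fun q _ => gapWeights_congr hw hkk q, hp]
      unfold insertMax
      split_ifs with h1 h2
      · exact hw i (by omega)
      · rfl
      · exact hw (i - 1) (by omega)

/-- The number of permutations of `d` elements with less than `k` ascents. -/
def lowCount (d k : ℕ) : ℕ := {σ : Equiv.Perm (Fin d) | ascents σ < k}.ncard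

theorem sum_runNumber (d k : ℕ) :
    ∑ i ∈ Finset.range k, runNumber d (i + 1) = lowCount d k := by
  classical
  simp only [runNumber_eq_card]
  rw [Finset.sum_comm, lowCount, Set.ncard_eq_toFinset_card', Set.toFinset_ofPred,
    Finset.card_filter]
  refine Finset.sum_congr rfl fun σ _ => ?_
  simp

theorem lowCount_min {d : ℕ} (hd : 1 ≤ d) (k : ℕ) : lowCount d (min k d) = lowCount d k := by
  unfold lowCount
  congr 1
  ext σ
  have := ascents_lt hd σ
  simp [this]

/-- The draw at index 0 has probability `runNumber d (ascents σ + 1) / lowCount d k` of selecting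
the right count, and the remaining box has the reciprocal of that numerator as its volume. The
result does not depend on `σ`. -/
theorem exists_box {d k : ℕ} (hd : 1 ≤ d) (σ : Equiv.Perm (Fin d)) (hσ : ascents σ < k) :
    ∃ A : ℕ → Set unitInterval, (∀ i, MeasurableSet (A i)) ∧
      ∏ i ∈ Finset.range (2 * d + 1), volume (A i) = ENNReal.ofReal (1 / lowCount d k) ∧
      ∀ u : ℕ → unitInterval, (∀ i < 2 * d + 1, u i ∈ A i) →
        level d k (fun l => u l) 0 = ascents σ + 1 ∧
        ∀ i < d, word d k (fun l => u l) d i = permWord σ i := by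
  obtain ⟨A, hA, hvol, hword⟩ := exists_box_word k le_rfl σ
  have hlt := ascents_lt hd σ
  have hR := runNumber_ascents_pos σ
  have hpos : 0 < lowCount d k := (Set.ncard_pos (Set.toFinite _)).2 ⟨σ, hσ⟩
  have hsum : ∑ i ∈ Finset.range (min k d), (runNumber d (i + 1) : ℝ) = lowCount d k := by
    rw [← lowCount_min hd, ← sum_runNumber]
    push_cast
    rfl
  have hR' : (0 : ℝ) < runNumber d (ascents σ + 1) := by exact_mod_cast hR
  have hpos' : (0 : ℝ) < lowCount d k := by exact_mod_cast hpos
  obtain ⟨B, hB, hBvol, hBpick⟩ := exists_set_pick (w := fun i => (runNumber d (i + 1) : ℝ))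
    (i := ascents σ) (n := min k d) (fun l => Nat.cast_nonneg _) (lt_min hσ hlt)
    (by rw [hsum]; exact hpos')
  rw [hsum] at hBvol
  refine ⟨fun i => if i = 0 then B else A i, fun i => ?_, ?_, fun u hu => ?_⟩ <;>
    beta_reduce at *
  · split_ifs
    exacts [hB, hA i]
  · have hI : Finset.range (2 * d + 1) = insert 0 (Finset.Ico (d - d + 1) (d + d + 1)) := by
      ext i
      simp only [Finset.mem_insert, Finset.mem_Ico, Finset.mem_range]
      omega
    rw [hI, Finset.prod_insert (by simp), Finset.prod_congr rfl (g := fun i => volume (A i)), hvol,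
      if_pos rfl, hBvol, ← ENNReal.ofReal_mul (by positivity)]
    · congr 1
      field_simp
    · intro i hi
      have := Finset.mem_Ico.1 hi
      rw [if_neg (by omega)]
  · have h0 := hu 0 (by omega)
    rw [if_pos rfl] at h0
    have hl : level d k (fun l => u l) 0 = ascents σ + 1 := by
      rw [level, hBpick _ h0, add_comm]
    refine ⟨hl, hword u (fun i hi => ?_) (by rw [Nat.sub_self]; exact hl)⟩
    have hi' := Finset.mem_Ico.1 hi
    have := hu i (by omega)
    rwa [if_neg (by omega)] at this

/-! ### Stanley's map preserves the volume of the cube -/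

/-- The open unit cube. -/
def openCube (d : ℕ) : Set (Fin d → ℝ) := {x | ∀ i, x i ∈ Set.Ioo (0 : ℝ) 1}

theorem openCube_eq_pi (d : ℕ) : openCube d = Set.univ.pi fun _ => Set.Ioo (0 : ℝ) 1 := by
  ext x
  simp [openCube]

theorem measurableSet_openCube (d : ℕ) : MeasurableSet (openCube d) := by
  rw [openCube_eq_pi]
  exact MeasurableSet.univ_pi fun _ => measurableSet_Ioo

theorem volume_openCube (d : ℕ) : volume (openCube d) = 1 := by
  simp [openCube_eq_pi, volume_pi_pi]

theorem restrict_openCube (d : ℕ) :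
    (volume : Measure (Fin d → ℝ)).restrict (openCube d) =
      Measure.pi fun _ => (volume : Measure ℝ).restrict (Set.Ioc 0 1) := by
  rw [openCube_eq_pi, volume_pi, Measure.restrict_pi_pi]
  congr 1
  funext _
  exact Measure.restrict_congr_set Ioo_ae_eq_Ioc

theorem ae_injective (d : ℕ) : ∀ᵐ x : Fin d → ℝ, Function.Injective x := by
  have h : ∀ i j : Fin d, i ≠ j → ∀ᵐ x : Fin d → ℝ, x i ≠ x j := by
    intro i j hij
    have h0 := Measure.addHaar_submodule (volume : Measure (Fin d → ℝ))
      (LinearMap.ker ((LinearMap.proj i : (Fin d → ℝ) →ₗ[ℝ] ℝ) - LinearMap.proj j)) (by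
        intro h
        have : Pi.single i (1 : ℝ) ∈ LinearMap.ker
            ((LinearMap.proj i : (Fin d → ℝ) →ₗ[ℝ] ℝ) - LinearMap.proj j) := by
          rw [h]; exact Submodule.mem_top
        simp [hij.symm] at this)
    rw [ae_iff]
    refine measure_mono_null (fun x hx => ?_) h0
    simpa [sub_eq_zero] using hx
  have h' : ∀ᵐ x : Fin d → ℝ, ∀ i j : Fin d, i ≠ j → x i ≠ x j := by
    rw [ae_all_iff]; intro i; rw [ae_all_iff]; intro j
    by_cases hij : i = j
    · simp [hij]
    · filter_upwards [h i j hij] with x hx _ using hx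
  filter_upwards [h'] with x hx i j hij
  by_contra hne
  exact hx i j hne hij

theorem measurable_prevCoord {d : ℕ} (i : Fin d) :
    Measurable fun x : Fin d → ℝ => prevCoord x i := by
  unfold prevCoord
  split_ifs
  · exact measurable_const
  · exact measurable_pi_apply _

theorem measurable_stanley (d : ℕ) : Measurable (stanley : (Fin d → ℝ) → Fin d → ℝ) := by
  classical
  refine measurable_pi_lambda _ fun i => ?_
  refine ((measurable_prevCoord i).sub (measurable_pi_apply i)).add (Measurable.ite ?_ ?_ ?_)
  · exact measurableSet_lt (measurable_prevCoord i) (measurable_pi_apply i)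
  · exact measurable_const
  · exact measurable_const

theorem prevCoord_mem {d : ℕ} {x : Fin d → ℝ} (hx : x ∈ openCube d) (i : Fin d) :
    prevCoord x i ∈ Set.Ico (0 : ℝ) 1 := by
  unfold prevCoord
  split_ifs
  · simp
  · exact ⟨(hx _).1.le, (hx _).2⟩

theorem stanley_mem {d : ℕ} {x : Fin d → ℝ} (hx : x ∈ openCube d) (hinj : Function.Injective x) :
    stanley x ∈ openCube d := by
  intro i
  have h1 := prevCoord_mem hx i
  have h2 := hx i
  have hne : prevCoord x i ≠ x i := by
    unfold prevCoord
    split_ifs with h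
    · exact h2.1.ne
    · refine fun he => h ?_
      have := congrArg Fin.val (hinj he)
      simp only at this
      omega
  unfold stanley
  obtain ⟨h1, h1'⟩ := h1
  obtain ⟨h2, h2'⟩ := h2
  split_ifs with h
  · constructor <;> linarith
  · have := lt_of_le_of_ne (not_lt.1 h) hne.symm
    constructor <;> linarith

/-- The endomorphism of the torus that Stanley's map induces. -/
def torusHom (d : ℕ) : (Fin d → UnitAddCircle) →+ (Fin d → UnitAddCircle) :=
  AddMonoidHom.mk' (fun t i => (if (i : ℕ) = 0 then 0 else
    t ⟨(i : ℕ) - 1, lt_of_le_of_lt (Nat.sub_le _ _) i.isLt⟩) - t i) fun t t' => by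
      funext i
      simp only [Pi.add_apply]
      split_ifs <;> abel

theorem torusHom_apply {d : ℕ} (t : Fin d → UnitAddCircle) (i : Fin d) :
    torusHom d t i = (if (i : ℕ) = 0 then 0 else
      t ⟨(i : ℕ) - 1, lt_of_le_of_lt (Nat.sub_le _ _) i.isLt⟩) - t i := rfl

theorem continuous_torusHom (d : ℕ) : Continuous (torusHom d) := by
  refine continuous_pi fun i => ?_
  simp only [torusHom_apply]
  split_ifs <;> fun_prop

theorem surjective_torusHom (d : ℕ) : Function.Surjective (torusHom d) := by
  intro s
  let s' : ℕ → UnitAddCircle := fun i => if h : i < d then s ⟨i, h⟩ else 0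
  -- Solving `t_{i-1} - t_i = s_i` with `t_{-1} = 0` gives negated partial sums.
  refine ⟨fun i => -∑ l ∈ Finset.range (i + 1), s' l, ?_⟩
  funext i
  have hs : s' i = s i := by simp [s']
  rw [torusHom_apply]
  split_ifs with h
  · simp [h, ← hs]
  · simp only
    rw [show (i : ℕ) - 1 + 1 = i by omega, Finset.sum_range_succ, hs]
    abel

/-- The image of Haar measure under a continuous surjective endomorphism is again translation
invariant with the same total mass, so uniqueness of Haar measure applies. -/
theorem measurePreserving_torusHom (d : ℕ) : MeasurePreserving (torusHom d) volume volume :=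
  (torusHom d).measurePreserving (continuous_torusHom d) (surjective_torusHom d) rfl

/-- Reduce modulo 1, apply the torus endomorphism, and lift back to `(0, 1]`: each stage preserves
measure. At points with distinct coordinates the composite is Stanley's map, whose indicator adds
the integer that brings the value back into the unit interval. -/
theorem measurePreserving_stanley (d : ℕ) :
    MeasurePreserving (stanley : (Fin d → ℝ) → Fin d → ℝ) (volume.restrict (openCube d))
      (volume.restrict (openCube d)) := by
  let g : UnitAddCircle → ℝ := fun t => (AddCircle.equivIoc (1 : ℝ) 0 t : ℝ)
  have hg : MeasurePreserving g volume (volume.restrict (Set.Ioc 0 1)) := by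
    have h : MeasurePreserving g volume (volume.restrict (Set.Ioc 0 (0 + 1))) :=
      (measurePreserving_subtype_coe measurableSet_Ioc).comp
        (AddCircle.measurePreserving_equivIoc (1 : ℝ) (a := 0))
    rwa [zero_add] at h
  have hmk : MeasurePreserving (fun x : ℝ => (x : UnitAddCircle))
      (volume.restrict (Set.Ioc 0 1)) volume := by
    have := UnitAddCircle.measurePreserving_mk 0
    rwa [zero_add] at this
  have hmk' := measurePreserving_pi (ι := Fin d) _ _ fun _ => hmk
  have hg' := measurePreserving_pi (ι := Fin d) _ _ fun _ => hg
  rw [← volume_pi, ← restrict_openCube] at hmk' hg'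
  have hall := hg'.comp ((measurePreserving_torusHom d).comp hmk')
  have hcoe : ∀ r : ℝ, r ∈ Set.Ioo (0 : ℝ) 1 → g (r : UnitAddCircle) = r := by
    intro r hr
    have hr' : r ∈ Set.Ioc (0 : ℝ) (0 + 1) := ⟨hr.1, by linarith [hr.2]⟩
    have := (AddCircle.equivIoc (1 : ℝ) 0).apply_symm_apply ⟨r, hr'⟩
    exact congrArg Subtype.val this
  refine ⟨measurable_stanley d, ?_⟩
  refine Eq.trans (Measure.map_congr ?_) hall.map_eq
  filter_upwards [ae_restrict_mem (measurableSet_openCube d), ae_restrict_of_ae (ae_injective d)]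
    with x hx hinj
  funext i
  have e : torusHom d (fun i => (x i : UnitAddCircle)) i = (stanley x i : UnitAddCircle) := by
    have e1 : torusHom d (fun i => (x i : UnitAddCircle)) i =
        ((prevCoord x i - x i : ℝ) : UnitAddCircle) := by
      rw [torusHom_apply, prevCoord]
      split_ifs <;> simp
    rw [e1, stanley]
    split_ifs
    · exact (AddCircle.coe_add_period (1 : ℝ) _).symm
    · rw [add_zero]
  simp only [Function.comp_apply]
  symm
  rw [e, hcoe _ (stanley_mem hx hinj i)]

/-- The differences telescope to `-x_d`. The indicators count the ascents of `0, x_1, …, x_d`, and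
the step from 0 to `x_1` is always one. -/
theorem sum_stanley {n : ℕ} {x : Fin (n + 1) → ℝ} (hx : x ∈ openCube (n + 1)) :
    ∑ i, stanley x i = ascents x + 1 - x (Fin.last n) := by
  classical
  have h0 : 0 < x 0 := (hx 0).1
  have hs : ∀ i : Fin n, stanley x i.succ =
      x i.castSucc - x i.succ + if x i.castSucc < x i.succ then 1 else 0 := by
    intro i
    have : prevCoord x i.succ = x i.castSucc := by
      unfold prevCoord
      rw [if_neg (by simp)]
      rfl
    simp only [stanley, this]
  have h00 : stanley x 0 = 1 - x 0 := by
    simp [stanley, prevCoord, h0, sub_eq_neg_add]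
  have htel : ∀ m : ℕ, ∀ y : Fin (m + 1) → ℝ,
      ∑ i : Fin m, (y i.castSucc - y i.succ) = y 0 - y (Fin.last m) := by
    intro m
    induction m with
    | zero => intro y; simp
    | succ m ih =>
      intro y
      rw [Fin.sum_univ_castSucc]
      have := ih fun i => y i.castSucc
      simp only [Fin.succ_castSucc] at this ⊢
      rw [this]
      simp
  rw [Fin.sum_univ_succ, h00, Finset.sum_congr rfl fun i _ => hs i, Finset.sum_add_distrib, htel,
    ascents_succ]
  push_cast
  ring

/-- The coordinate sum lies strictly between the integers `ascents x` and `ascents x + 1`. -/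
theorem stanley_mem_cubeBelow {d : ℕ} (hd : 1 ≤ d) {x : Fin d → ℝ} (hx : x ∈ openCube d)
    (hinj : Function.Injective x) (j : ℕ) : stanley x ∈ cubeBelow d j ↔ ascents x < j := by
  obtain ⟨n, rfl⟩ : ∃ n, d = n + 1 := ⟨d - 1, by omega⟩
  have hl := hx (Fin.last n)
  simp only [cubeBelow, Set.mem_ofPred_eq, sum_stanley hx]
  constructor
  · rintro ⟨-, h⟩
    have : (ascents x : ℝ) < j := by linarith [hl.2]
    exact_mod_cast this
  · intro h
    refine ⟨stanley_mem hx hinj, ?_⟩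
    have : ((ascents x + 1 : ℕ) : ℝ) ≤ j := by exact_mod_cast h
    push_cast at this
    linarith [hl.1]

/-! ### Decomposition of the cube into simplices, and the volumes of the slices -/

theorem measurePreserving_comp_perm {d : ℕ} (σ : Equiv.Perm (Fin d)) :
    MeasurePreserving (fun z : Fin d → ℝ => z ∘ σ) volume volume := by
  have h := volume_measurePreserving_piCongrLeft (fun _ : Fin d => ℝ) σ.symm
  convert h using 1
  funext z i
  have := Equiv.piCongrLeft_apply_apply (fun _ : Fin d => ℝ) σ.symm z (σ i)
  rw [σ.symm_apply_apply] at this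
  exact this.symm

theorem measurableSet_fundamentalSimplex (d : ℕ) : MeasurableSet (fundamentalSimplex d) := by
  have : fundamentalSimplex d =
      openCube d ∩ ⋂ i : Fin d, ⋂ j : Fin d, {x | i < j → x i < x j} := by
    ext x
    simp only [fundamentalSimplex, openCube, Set.mem_inter_iff, Set.mem_ofPred_eq, Set.mem_iInter]
    rfl
  rw [this]
  refine (measurableSet_openCube d).inter (.iInter fun i => .iInter fun j => ?_)
  by_cases h : i < j
  · simp only [h, true_imp_iff]
    exact measurableSet_lt (measurable_pi_apply i) (measurable_pi_apply j)
  · simp [h]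

/-- The simplex `{x ∘ σ : x ∈ Δ}` of the points of the cube whose coordinates are ordered like the
values of `σ`. -/
def permCell {d : ℕ} (σ : Equiv.Perm (Fin d)) : Set (Fin d → ℝ) :=
  (fun z : Fin d → ℝ => z ∘ σ.symm) ⁻¹' fundamentalSimplex d

theorem measurableSet_permCell {d : ℕ} (σ : Equiv.Perm (Fin d)) : MeasurableSet (permCell σ) :=
  (measurePreserving_comp_perm σ.symm).measurable (measurableSet_fundamentalSimplex d)

theorem volume_permCell {d : ℕ} (σ : Equiv.Perm (Fin d)) :
    volume (permCell σ) = volume (fundamentalSimplex d) :=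
  (measurePreserving_comp_perm σ.symm).measure_preimage
    (measurableSet_fundamentalSimplex d).nullMeasurableSet

theorem permCell_subset {d : ℕ} (σ : Equiv.Perm (Fin d)) : permCell σ ⊆ openCube d := by
  intro z hz i
  have := hz.1 (σ i)
  simpa using this

theorem ascents_of_mem_permCell {d : ℕ} {σ : Equiv.Perm (Fin d)} {z : Fin d → ℝ}
    (hz : z ∈ permCell σ) : ascents z = ascents σ := by
  have h : ∀ i j, z i < z j ↔ σ i < σ j := by
    intro i j
    have := (hz.2 : StrictMono (z ∘ σ.symm)).lt_iff_lt (a := σ i) (b := σ j)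
    simpa using this
  unfold ascents
  simp only [h]

theorem exists_mem_permCell {d : ℕ} {z : Fin d → ℝ} (hz : z ∈ openCube d)
    (hinj : Function.Injective z) : ∃ σ : Equiv.Perm (Fin d), z ∈ permCell σ := by
  refine ⟨(Tuple.sort z).symm, fun i => hz _, ?_⟩
  exact (Tuple.monotone_sort z).strictMono_of_injective (hinj.comp (Equiv.injective _))

theorem permCell_disjoint {d : ℕ} {σ τ : Equiv.Perm (Fin d)} (h : σ ≠ τ) :
    Disjoint (permCell σ) (permCell τ) := by
  rw [Set.disjoint_left]
  intro z hσ hτ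
  apply h
  have e := Tuple.unique_monotone (StrictMono.monotone hσ.2) (StrictMono.monotone hτ.2)
  have hinj : Function.Injective z := by
    have := (StrictMono.injective hσ.2).comp σ.injective
    rwa [Function.comp_assoc, Equiv.symm_comp_self, Function.comp_id] at this
  have : σ.symm = τ.symm := by
    ext i
    exact congrArg Fin.val (hinj (congrFun e i))
  rw [← σ.symm_symm, this, τ.symm_symm]

/-- Almost every point of the cube has distinct coordinates and hence lies in exactly one cell, on
which the number of ascents is constant. Stated for measures, this serves both the volumes and the
output law. -/
theorem restrict_preimage_stanley {d : ℕ} {Q : Set (Fin d → ℝ)} (hQ : MeasurableSet Q)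
    {p : ℕ → Prop}
    (h : ∀ x ∈ openCube d, Function.Injective x → (stanley x ∈ Q ↔ p (ascents x))) :
    (volume.restrict (openCube d)).restrict (stanley ⁻¹' Q) =
      Measure.sum fun σ : {σ : Equiv.Perm (Fin d) // p (ascents σ)} =>
        volume.restrict (permCell σ.1) := by
  rw [Measure.restrict_restrict (measurable_stanley d hQ),
    ← Measure.restrict_iUnion (fun σ τ hστ => permCell_disjoint fun he => hστ (Subtype.ext he))
      fun σ => measurableSet_permCell σ.1]
  refine Measure.restrict_congr_set ?_
  filter_upwards [ae_injective d] with x hinj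
  refine propext ?_
  change x ∈ stanley ⁻¹' Q ∩ openCube d ↔ x ∈ ⋃ σ : {σ : Equiv.Perm (Fin d) // p (ascents σ)}, permCell σ.1
  rw [Set.mem_iUnion]
  constructor
  · rintro ⟨h1, h2⟩
    obtain ⟨σ, hσ⟩ := exists_mem_permCell h2 hinj
    refine ⟨⟨σ, ?_⟩, hσ⟩
    rw [← ascents_of_mem_permCell hσ]
    exact (h x h2 hinj).1 h1
  · rintro ⟨σ, hσ⟩
    have h2 := permCell_subset _ hσ
    refine ⟨(h x h2 hinj).2 ?_, h2⟩
    rw [ascents_of_mem_permCell hσ]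
    exact σ.2

theorem volume_of_stanley_mem_iff {d : ℕ} {Q : Set (Fin d → ℝ)} (hQ : MeasurableSet Q)
    (hQc : Q ⊆ openCube d) {p : ℕ → Prop}
    (h : ∀ x ∈ openCube d, Function.Injective x → (stanley x ∈ Q ↔ p (ascents x))) :
    volume Q = ({σ : Equiv.Perm (Fin d) | p (ascents σ)}.ncard : ℝ≥0∞) *
      volume (fundamentalSimplex d) := by
  classical
  have h1 := congrArg (fun μ : Measure (Fin d → ℝ) => μ Set.univ)
    (restrict_preimage_stanley hQ h)
  simp only [Measure.restrict_apply_univ] at h1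
  rw [(measurePreserving_stanley d).measure_preimage hQ.nullMeasurableSet,
    Measure.restrict_apply hQ, Set.inter_eq_left.2 hQc, Measure.sum_apply _ MeasurableSet.univ,
    tsum_fintype] at h1
  simp only [Measure.restrict_apply_univ, volume_permCell, Finset.sum_const, Finset.card_univ,
    nsmul_eq_mul] at h1
  rw [h1, ← Nat.card_eq_fintype_card]
  rfl

/-- The decomposition of the whole cube, under the trivial condition on ascents, already shows that
`d!` copies fill volume one. -/
theorem volume_fundamentalSimplex (d : ℕ) : volume (fundamentalSimplex d) = (d ! : ℝ≥0∞)⁻¹ := by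
  have h := volume_of_stanley_mem_iff (measurableSet_openCube d) subset_rfl (p := fun _ => True)
    fun x hx hinj => iff_of_true (stanley_mem hx hinj) trivial
  rw [volume_openCube, show {σ : Equiv.Perm (Fin d) | True} = Set.univ from Set.eq_univ_of_forall fun _ => trivial,
    Set.ncard_univ, Nat.card_eq_fintype_card, Fintype.card_perm,
    Fintype.card_fin] at h
  exact ENNReal.eq_inv_of_mul_eq_one_left (by rw [mul_comm]; exact h.symm)

theorem measurableSet_cubeBelow (d j : ℕ) : MeasurableSet (cubeBelow d j) := by
  have : cubeBelow d j = openCube d ∩ {x | ∑ i, x i ≤ (j : ℝ)} := rfl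
  rw [this]
  exact (measurableSet_openCube d).inter (measurableSet_le (by fun_prop) measurable_const)

theorem volume_slice {d j : ℕ} (hd : 1 ≤ d) (hj : 1 ≤ j) :
    volume (slice d j) = (eulerian d (j - 1) : ℝ≥0∞) / (d ! : ℝ≥0∞) := by
  rw [slice, volume_of_stanley_mem_iff (p := fun a => a = j - 1)
    ((measurableSet_cubeBelow d j).diff (measurableSet_cubeBelow d (j - 1)))
    (fun x hx => hx.1.1), volume_fundamentalSimplex, div_eq_mul_inv]
  · rfl
  · intro x hx hinj
    change (stanley x ∈ cubeBelow d j ∧ ¬ stanley x ∈ cubeBelow d (j - 1)) ↔ _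
    rw [stanley_mem_cubeBelow hd hx hinj, stanley_mem_cubeBelow hd hx hinj]
    omega

/-! ### The law of the transcript and of the output -/

theorem lintegral_uniformOn {α : Type*} [MeasurableSpace α] [MeasurableSingletonClass α]
    (S : Finset α) (f : α → ℝ≥0∞) :
    ∫⁻ a, f a ∂(uniformOn (S : Set α)) = (S.card : ℝ≥0∞)⁻¹ * ∑ a ∈ S, f a := by
  rw [uniformOn, ProbabilityTheory.cond, lintegral_smul_measure, lintegral_finset,
    Measure.count_apply_finset, smul_eq_mul]
  simp

/-- The sign vectors as a finite set. -/
def signFinset (d : ℕ) : Finset (Fin d → ℝ) :=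
  open scoped Classical in Fintype.piFinset fun _ => {-1, 1}

theorem mem_signFinset {d : ℕ} {s : Fin d → ℝ} : s ∈ signFinset d ↔ ∀ i, s i = -1 ∨ s i = 1 := by
  simp [signFinset]

theorem coe_signFinset (d : ℕ) : (signFinset d : Set (Fin d → ℝ)) = signVectors d := by
  ext s
  simp [mem_signFinset, signVectors]

theorem card_signFinset_pos (d : ℕ) : 0 < (signFinset d).card :=
  Finset.card_pos.2 ⟨fun _ => 1, mem_signFinset.2 fun _ => Or.inr rfl⟩

instance (d : ℕ) : IsProbabilityMeasure (uniformOn (signVectors d)) := by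
  rw [← coe_signFinset]
  exact isProbabilityMeasure_uniformOn (Finset.finite_toSet _) (Finset.card_pos.1 (card_signFinset_pos d))

instance (d : ℕ) :
    IsProbabilityMeasure (ProbabilityTheory.cond volume (fundamentalSimplex d)) := by
  refine cond_isProbabilityMeasure_of_finite ?_ ?_ <;> rw [volume_fundamentalSimplex]
  · simp
  · exact ENNReal.inv_ne_top.2 (by exact_mod_cast d.factorial_ne_zero)

/-- The law of the point of the simplex and the signs. -/
def pointSignLaw (d : ℕ) : Measure ((Fin d → ℝ) × (Fin d → ℝ)) :=
  (ProbabilityTheory.cond volume (fundamentalSimplex d)).prod (uniformOn (signVectors d))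

instance (d : ℕ) : IsProbabilityMeasure (pointSignLaw d) := by
  unfold pointSignLaw; infer_instance

theorem measurable_signed_stanley {d : ℕ} (σ : Equiv.Perm (Fin d)) :
    Measurable fun (p : (Fin d → ℝ) × (Fin d → ℝ)) (i : Fin d) =>
      p.2 i * stanley (fun l => p.1 (σ l)) i := by
  refine measurable_pi_lambda _ fun i => ?_
  refine ((measurable_pi_apply i).comp measurable_snd).mul ?_
  exact (measurable_pi_apply i).comp ((measurable_stanley d).comp
    ((measurePreserving_comp_perm σ).measurable.comp measurable_fst))

theorem measurable_mkTranscript_pair {d : ℕ} (j : ℕ) (σ : Equiv.Perm (Fin d)) :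
    Measurable fun p : (Fin d → ℝ) × (Fin d → ℝ) => mkTranscript j (σ, p) :=
  (measurable_const (a := j)).prodMk ((measurable_const (a := fun i => (σ i : ℕ))).prodMk
    (measurable_fst.prodMk (measurable_snd.prodMk (measurable_signed_stanley σ))))

theorem measurable_mkTranscript {d : ℕ} (j : ℕ) : Measurable (mkTranscript (d := d) j) :=
  measurable_from_prod_countable_right fun σ => measurable_mkTranscript_pair j σ

open scoped Classical in
theorem map_mkTranscript_apply {d j : ℕ} (p : ℕ → Prop) {E : Set (Transcript d)}
    (hE : MeasurableSet E) :
    ((uniformOn {σ : Equiv.Perm (Fin d) | p (ascents σ)}).prod (pointSignLaw d)).map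
      (mkTranscript j) E =
      ({σ : Equiv.Perm (Fin d) | p (ascents σ)}.ncard : ℝ≥0∞)⁻¹ *
        ∑ σ : Equiv.Perm (Fin d), if p (ascents σ) then
          pointSignLaw d {q | mkTranscript j (σ, q) ∈ E} else 0 := by
  have hS : {σ : Equiv.Perm (Fin d) | p (ascents σ)} =
      ((Finset.univ.filter fun σ : Equiv.Perm (Fin d) => p (ascents σ) : Finset _) : Set _) := by
    ext σ; simp
  rw [Measure.map_apply (measurable_mkTranscript j) hE,
    Measure.prod_apply (measurable_mkTranscript j hE), hS, lintegral_uniformOn, Set.ncard_coe_finset,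
    Finset.sum_filter]
  rfl

/-- The common factor `1 / d!` drops out of the slice probabilities. -/
theorem volume_slice_div {d k j : ℕ} (hd : 1 ≤ d) (hj : 1 ≤ j) :
    volume (slice d j) / ∑ i ∈ Finset.Icc 1 k, volume (slice d i) =
      (eulerian d (j - 1) : ℝ≥0∞) / (lowCount d k : ℝ≥0∞) := by
  have hsum : ∑ i ∈ Finset.Icc 1 k, volume (slice d i) = (lowCount d k : ℝ≥0∞) / (d ! : ℝ≥0∞) := by
    rw [Finset.sum_congr rfl fun i hi => volume_slice hd (Finset.mem_Icc.1 hi).1,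
      ← sum_runNumber, Finset.range_eq_Ico, Nat.cast_sum]
    simp only [div_eq_mul_inv]
    rw [Finset.sum_mul]
    refine (Finset.sum_bij (fun i _ => i + 1) ?_ ?_ ?_ ?_).symm
    · intro i hi
      have := Finset.mem_Ico.1 hi
      exact Finset.mem_Icc.2 ⟨by omega, by omega⟩
    · intro i _ j _ h
      omega
    · intro i hi
      have := Finset.mem_Icc.1 hi
      exact ⟨i - 1, Finset.mem_Ico.2 ⟨by omega, by omega⟩, by omega⟩
    · intro i _
      rw [runNumber_succ_eq_eulerian, Nat.add_sub_cancel]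
  have hf : (d ! : ℝ≥0∞) ≠ 0 := by exact_mod_cast d.factorial_ne_zero
  rw [hsum, volume_slice hd hj, div_eq_mul_inv, div_eq_mul_inv, div_eq_mul_inv, div_eq_mul_inv,
    ENNReal.mul_inv (Or.inr (by simp [Nat.factorial_ne_zero])) (Or.inr (by simp)), inv_inv]
  rw [mul_mul_mul_comm, ENNReal.inv_mul_cancel hf (by simp), mul_one]

-- Regrouping by permutation: each one occurs for a single `j`, with probability `A / lowCount`
-- times `1 / A`. Its marginal law is thus uniform on permutations with fewer than `k` ascents.
open scoped Classical in
theorem transcriptLaw_apply {d : ℕ} (hd : 1 ≤ d) (k : ℕ) {E : Set (Transcript d)}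
    (hE : MeasurableSet E) :
    transcriptLaw d k E = (lowCount d k : ℝ≥0∞)⁻¹ *
      ∑ σ : Equiv.Perm (Fin d), if ascents σ < k then
        pointSignLaw d {q | mkTranscript (ascents σ + 1) (σ, q) ∈ E} else 0 := by
  unfold transcriptLaw
  rw [Measure.coe_finsetSum, Finset.sum_apply]
  have hj : ∀ j ∈ Finset.Icc 1 k, ((volume (slice d j) / ∑ i ∈ Finset.Icc 1 k, volume (slice d i)) •
      ((uniformOn (permsWithAscents d (j - 1))).prod
        ((ProbabilityTheory.cond volume (fundamentalSimplex d)).prod (uniformOn (signVectors d)))).map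
          (mkTranscript j)) E = (lowCount d k : ℝ≥0∞)⁻¹ *
      ∑ σ : Equiv.Perm (Fin d), if ascents σ = j - 1 then
        pointSignLaw d {q | mkTranscript (ascents σ + 1) (σ, q) ∈ E} else 0 := by
    intro j hj
    have hj1 := (Finset.mem_Icc.1 hj).1
    have h := map_mkTranscript_apply (j := j) (fun a => a = j - 1) hE
    rw [Measure.smul_apply, smul_eq_mul, volume_slice_div hd hj1]
    have hsum : ∀ σ : Equiv.Perm (Fin d), @ite _ (ascents σ = j - 1) (Classical.propDecidable _)
        (pointSignLaw d {q | mkTranscript j (σ, q) ∈ E}) 0 = if ascents σ = j - 1 then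
        pointSignLaw d {q | mkTranscript (ascents σ + 1) (σ, q) ∈ E} else 0 := by
      intro σ
      by_cases hσ : ascents σ = j - 1
      · rw [if_pos hσ, if_pos hσ, hσ, Nat.sub_add_cancel hj1]
      · rw [if_neg hσ, if_neg hσ]
    refine (congrArg _ (h.trans (congrArg _ (Finset.sum_congr rfl fun σ _ => hsum σ)))).trans ?_
    change (eulerian d (j - 1) : ℝ≥0∞) / _ * ((eulerian d (j - 1) : ℝ≥0∞)⁻¹ * _) = _
    -- Cancelling the Eulerian number needs it nonzero. It vanishes for slices beyond the cube (`j >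
    -- d`), where both sides are zero.
    by_cases h0 : eulerian d (j - 1) = 0
    · have hne : ∀ σ : Equiv.Perm (Fin d), ascents σ ≠ j - 1 := by
        intro σ hσ
        have : permsWithAscents d (j - 1) = ∅ := (Set.ncard_eq_zero (Set.toFinite _)).1 h0
        exact (this ▸ hσ : σ ∈ (∅ : Set (Equiv.Perm (Fin d))))
      simp [hne]
    · have h0' : (eulerian d (j - 1) : ℝ≥0∞) ≠ 0 := by exact_mod_cast h0
      rw [div_eq_mul_inv, mul_comm (eulerian d (j - 1) : ℝ≥0∞), mul_assoc, ← mul_assoc _ _⁻¹,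
        ENNReal.mul_inv_cancel h0' (by simp), one_mul]
  rw [Finset.sum_congr rfl hj, ← Finset.mul_sum, Finset.sum_comm]
  congr 1
  refine Finset.sum_congr rfl fun σ _ => ?_
  split_ifs with hσ
  · rw [Finset.sum_eq_single (ascents σ + 1)]
    · simp
    · intro j hj hne
      have := (Finset.mem_Icc.1 hj).1
      rw [if_neg (by omega)]
    · intro h
      exact absurd (Finset.mem_Icc.2 ⟨by omega, by omega⟩) h
  · refine Finset.sum_eq_zero fun j hj => ?_
    have := Finset.mem_Icc.1 hj
    rw [if_neg (by omega)]

theorem lowCount_pos {d k : ℕ} (hd : 1 ≤ d) (hk : 1 ≤ k) : 0 < lowCount d k := by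
  -- The decreasing permutation has no ascents.
  refine (Set.ncard_pos (Set.toFinite _)).2 ⟨Fin.revPerm, ?_⟩
  obtain ⟨n, rfl⟩ : ∃ n, d = n + 1 := ⟨d - 1, by omega⟩
  have : ascents (Fin.revPerm : Equiv.Perm (Fin (n + 1))) = 0 := by
    rw [ascents_succ]
    refine Finset.sum_eq_zero fun i _ => if_neg ?_
    rw [Fin.revPerm_apply, Fin.revPerm_apply, Fin.rev_lt_rev]
    exact (Fin.castSucc_lt_succ).not_gt
  change ascents (Fin.revPerm : Equiv.Perm (Fin (n + 1))) < k
  omega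

theorem isProbabilityMeasure_transcriptLaw {d k : ℕ} (hd : 1 ≤ d) (hk : 1 ≤ k) :
    IsProbabilityMeasure (transcriptLaw d k) := by
  classical
  refine ⟨?_⟩
  rw [transcriptLaw_apply hd k MeasurableSet.univ]
  simp only [Set.mem_univ]
  rw [show {q : (Fin d → ℝ) × (Fin d → ℝ) | True} = Set.univ from
    Set.eq_univ_of_forall fun _ => trivial, measure_univ, ← Nat.cast_one, ← Nat.cast_zero]
  have : (∑ σ : Equiv.Perm (Fin d), if ascents σ < k then ((1 : ℕ) : ℝ≥0∞) else ((0 : ℕ) : ℝ≥0∞)) =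
      (lowCount d k : ℝ≥0∞) := by
    rw [lowCount, Set.ncard_eq_toFinset_card', Set.toFinset_ofPred, Finset.card_filter, Nat.cast_sum]
    exact Finset.sum_congr rfl fun σ _ => by split_ifs <;> rfl
  rw [this, Nat.cast_one]
  exact ENNReal.inv_mul_cancel (by exact_mod_cast (lowCount_pos hd hk).ne') (by simp)

/-! ### From the simplices through the cube to the Sum ball. -/

theorem cubeBelow_subset (d j : ℕ) : cubeBelow d j ⊆ openCube d := fun _ h => h.1

-- Permuting coordinates moves the simplex to the cell of `σ`; the cells with fewer than `k` ascents
-- make up the preimage of `cubeBelow d k`, and Stanley's map preserves volume.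
open scoped Classical in
theorem sum_volume_stanley {d : ℕ} (hd : 1 ≤ d) (k : ℕ) {E : Set (Fin d → ℝ)}
    (hE : MeasurableSet E) :
    (∑ σ : Equiv.Perm (Fin d), if ascents σ < k then
      volume (fundamentalSimplex d ∩ {x | stanley (fun l => x (σ l)) ∈ E}) else 0) =
      volume (E ∩ cubeBelow d k) := by
  have h1 := restrict_preimage_stanley (measurableSet_cubeBelow d k) (p := fun a => a < k)
    fun x hx hinj => stanley_mem_cubeBelow hd hx hinj k
  have h2 := ((measurePreserving_stanley d).restrict_preimage
    (measurableSet_cubeBelow d k)).measure_preimage hE.nullMeasurableSet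
  rw [h1, Measure.restrict_restrict (measurableSet_cubeBelow d k),
    Set.inter_eq_left.2 (cubeBelow_subset d k), Measure.restrict_apply hE,
    Measure.sum_apply _ (measurable_stanley d hE), tsum_fintype] at h2
  rw [← h2, ← Finset.sum_filter, ← Finset.sum_subtype_eq_sum_filter]
  refine Finset.sum_congr (by ext; simp) fun σ _ => ?_
  rw [Measure.restrict_apply (measurable_stanley d hE),
    ← (measurePreserving_comp_perm σ.1).measure_preimage
      ((measurable_stanley d hE).inter (measurableSet_permCell σ.1)).nullMeasurableSet]
  congr 1
  ext x
  have : (x ∘ σ.1) ∘ σ.1.symm = x := by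
    funext i; simp
  simp only [Set.mem_inter_iff, Set.mem_preimage, permCell, this]
  exact and_comm

theorem measurePreserving_signMul {d : ℕ} {s : Fin d → ℝ} (hs : s ∈ signFinset d) :
    MeasurePreserving (fun (x : Fin d → ℝ) i => s i * x i) volume volume := by
  refine volume_preserving_pi (f := fun i t => s i * t) fun i => ?_
  rcases mem_signFinset.1 hs i with h | h
  · simpa [h] using Measure.measurePreserving_neg (volume : Measure ℝ)
  · simp only [h, one_mul]
    exact MeasurePreserving.id _

theorem signMul_signMul {d : ℕ} {s : Fin d → ℝ} (hs : s ∈ signFinset d) (x : Fin d → ℝ) :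
    (fun i => s i * (s i * x i)) = x := by
  funext i
  rcases mem_signFinset.1 hs i with h | h <;> simp [h]

theorem pairwiseDisjoint_signMul_cubeBelow (d k : ℕ) :
    (signFinset d : Set (Fin d → ℝ)).PairwiseDisjoint
      fun s => (fun (x : Fin d → ℝ) i => s i * x i) ⁻¹' cubeBelow d k := by
  intro s hs s' hs' hne
  refine Set.disjoint_left.2 fun x hx hx' => hne (funext fun i => ?_)
  have h := (hx.1 i).1
  have h' := (hx'.1 i).1
  rcases mem_signFinset.1 hs i with e | e <;> rcases mem_signFinset.1 hs' i with e' | e' <;>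
    rw [e, e'] <;> simp only [e, e'] at h h' <;> linarith

/-- Away from the null set where a coordinate is `0`, `1` or `-1`, multiplying by the signs of the
coordinates takes absolute values and lands in the open cube. -/
theorem ae_mem_signMul_cubeBelow (d k : ℕ) : ∀ᵐ y : Fin d → ℝ,
    y ∈ sumBall d k ↔ y ∈ ⋃ s ∈ signFinset d, (fun (x : Fin d → ℝ) i => s i * x i) ⁻¹' cubeBelow d k := by
  have hne (c : ℝ) : ∀ᵐ y : Fin d → ℝ, ∀ i, y i ≠ c :=
    ae_all_iff.2 fun i => Measure.ae_eval_ne (μ := fun _ : Fin d => (volume : Measure ℝ)) i c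
  filter_upwards [hne 0, hne 1, hne (-1)] with y h0 h1 h2
  constructor
  · rintro ⟨hy, hy'⟩
    refine Set.mem_iUnion₂.2 ⟨fun i => if y i < 0 then -1 else 1, mem_signFinset.2 fun i => ?_, ?_⟩
    · by_cases h : y i < 0 <;> simp [h]
    · have habs : (fun i => (if y i < 0 then -1 else 1) * y i) = fun i => |y i| := by
        funext i
        split_ifs with h
        · rw [abs_of_neg h]; ring
        · rw [abs_of_nonneg (not_lt.1 h), one_mul]
      change (fun i => (if y i < 0 then -1 else 1) * y i) ∈ cubeBelow d k
      rw [habs]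
      refine ⟨fun i => ⟨abs_pos.2 (h0 i), lt_of_le_of_ne (hy' i) fun h => ?_⟩, hy⟩
      rcases eq_or_eq_neg_of_abs_eq h with h | h
      · exact h1 i h
      · exact h2 i h
  · intro h
    obtain ⟨s, hs, hm, hsum⟩ := Set.mem_iUnion₂.1 h
    have habs : ∀ i, |y i| = s i * y i := by
      intro i
      have hi : 0 < s i * y i := (hm i).1
      rw [← abs_of_pos hi, abs_mul]
      rcases mem_signFinset.1 hs i with e | e <;> simp [e]
    refine ⟨?_, fun i => ?_⟩
    · change ∑ i, |y i| ≤ (k : ℝ)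
      rw [Finset.sum_congr rfl fun i _ => habs i]
      exact hsum
    · rw [habs i]
      exact (hm i).2.le

theorem sum_volume_signMul {d : ℕ} (k : ℕ) {E : Set (Fin d → ℝ)} (hE : MeasurableSet E) :
    ∑ s ∈ signFinset d, volume ((fun (x : Fin d → ℝ) i => s i * x i) ⁻¹' E ∩ cubeBelow d k) =
      volume (E ∩ sumBall d k) := by
  have hm : ∀ s ∈ signFinset d,
      MeasurableSet ((fun (x : Fin d → ℝ) i => s i * x i) ⁻¹' cubeBelow d k) := fun s hs =>
    (measurePreserving_signMul hs).measurable (measurableSet_cubeBelow d k)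
  have h1 : ∀ s ∈ signFinset d,
      volume ((fun (x : Fin d → ℝ) i => s i * x i) ⁻¹' E ∩ cubeBelow d k) =
        volume (E ∩ (fun (x : Fin d → ℝ) i => s i * x i) ⁻¹' cubeBelow d k) := by
    intro s hs
    rw [← (measurePreserving_signMul hs).measure_preimage (hE.inter (hm s hs)).nullMeasurableSet,
      Set.preimage_inter, ← Set.preimage_comp]
    congr 2
    ext x
    change _ ↔ (fun i => s i * (s i * x i)) ∈ cubeBelow d k
    rw [signMul_signMul hs]
  rw [Finset.sum_congr rfl h1, ← measure_biUnion_finset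
    (fun s hs s' hs' hne => ((pairwiseDisjoint_signMul_cubeBelow d k) hs hs' hne).mono
      Set.inter_subset_right Set.inter_subset_right) fun s hs => hE.inter (hm s hs),
    ← Set.inter_iUnion₂]
  refine measure_congr ?_
  filter_upwards [ae_mem_signMul_cubeBelow d k] with y hy
  exact propext (and_congr_right fun _ => hy.symm)

theorem pointSignLaw_signed_stanley {d : ℕ} (σ : Equiv.Perm (Fin d)) {E : Set (Fin d → ℝ)}
    (hE : MeasurableSet E) :
    pointSignLaw d {q | (fun i => q.2 i * stanley (fun l => q.1 (σ l)) i) ∈ E} =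
      ((signFinset d).card : ℝ≥0∞)⁻¹ * ∑ s ∈ signFinset d, (volume (fundamentalSimplex d))⁻¹ *
        volume (fundamentalSimplex d ∩
          {x | stanley (fun l => x (σ l)) ∈ (fun (x : Fin d → ℝ) i => s i * x i) ⁻¹' E}) := by
  rw [pointSignLaw]
  refine (Measure.prod_apply_symm (measurable_signed_stanley σ hE)).trans ?_
  rw [← coe_signFinset, lintegral_uniformOn]
  congr 1
  refine Finset.sum_congr rfl fun s _ => ?_
  rw [cond_apply (measurableSet_fundamentalSimplex d)]
  rfl

/-- It suffices to show proportionality to Lebesgue measure on the ball: the total mass one then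
determines the constant. -/
theorem map_output_transcriptLaw {d k : ℕ} (hd : 1 ≤ d) (hk : 1 ≤ k) :
    (transcriptLaw d k).map (fun t => t.2.2.2.2) = ProbabilityTheory.cond volume (sumBall d k) := by
  classical
  have hmeas : Measurable fun t : Transcript d => t.2.2.2.2 :=
    measurable_snd.comp (measurable_snd.comp (measurable_snd.comp measurable_snd))
  obtain ⟨c, hc⟩ : ∃ c : ℝ≥0∞, (transcriptLaw d k).map (fun t => t.2.2.2.2) =
      c • volume.restrict (sumBall d k) := by
    refine ⟨(lowCount d k : ℝ≥0∞)⁻¹ * (((signFinset d).card : ℝ≥0∞)⁻¹ *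
      (volume (fundamentalSimplex d))⁻¹), Measure.ext fun E hE => ?_⟩
    rw [Measure.map_apply hmeas hE, transcriptLaw_apply hd k (hmeas hE), Measure.smul_apply,
      Measure.restrict_apply hE, smul_eq_mul, mul_assoc, mul_assoc, ← sum_volume_signMul k hE]
    congr 1
    have h1 : ∀ σ : Equiv.Perm (Fin d), (if ascents σ < k then pointSignLaw d
        {q | mkTranscript (ascents σ + 1) (σ, q) ∈ (fun t : Transcript d => t.2.2.2.2) ⁻¹' E} else 0) =
        ((signFinset d).card : ℝ≥0∞)⁻¹ * ((volume (fundamentalSimplex d))⁻¹ *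
          ∑ s ∈ signFinset d, if ascents σ < k then volume (fundamentalSimplex d ∩
          {x | stanley (fun l => x (σ l)) ∈ (fun (x : Fin d → ℝ) i => s i * x i) ⁻¹' E}) else 0) := by
      intro σ
      split_ifs
      · rw [Finset.mul_sum]
        exact pointSignLaw_signed_stanley σ hE
      · simp
    rw [Finset.sum_congr rfl fun σ _ => h1 σ, ← Finset.mul_sum, ← Finset.mul_sum, Finset.sum_comm]
    congr 2
    refine Finset.sum_congr rfl fun s hs => ?_
    rw [← sum_volume_stanley hd k ((measurePreserving_signMul hs).measurable hE)]
  have hp := isProbabilityMeasure_transcriptLaw hd hk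
  have h1 : c * volume (sumBall d k) = 1 := by
    have := (Measure.isProbabilityMeasure_map (μ := transcriptLaw d k) hmeas.aemeasurable).measure_univ
    rwa [hc, Measure.smul_apply, Measure.restrict_apply_univ, smul_eq_mul] at this
  rw [hc, ProbabilityTheory.cond, ENNReal.eq_inv_of_mul_eq_one_left h1]

/-! ### Laws of the building blocks of the sampler -/

/-- The law of a map that is given piece by piece. -/
theorem map_eq_sum_restrict {ι α β : Type*} [Countable ι] {_ : MeasurableSpace α}
    {_ : MeasurableSpace β} {μ : Measure α} {A : ι → Set α} {F : α → β} {G : ι → α → β}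
    (hA : ∀ i, MeasurableSet (A i)) (hdisj : Pairwise (Function.onFun Disjoint A))
    (hcover : ∀ᵐ a ∂μ, a ∈ ⋃ i, A i) (hG : ∀ i, Measurable (G i))
    (hF : ∀ i, F =ᵐ[μ.restrict (A i)] G i) :
    AEMeasurable F μ ∧ μ.map F = Measure.sum fun i => (μ.restrict (A i)).map (G i) := by
  have hμ : μ = Measure.sum fun i => μ.restrict (A i) := by
    rw [← Measure.restrict_iUnion hdisj hA, Measure.restrict_eq_self_of_ae_mem hcover]
  have hm : AEMeasurable F (Measure.sum fun i => μ.restrict (A i)) :=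
    aemeasurable_sum_measure_iff.2 fun i => (hG i).aemeasurable.congr (hF i).symm
  refine ⟨hμ ▸ hm, ?_⟩
  conv_lhs => rw [hμ]
  rw [Measure.map_sum hm]
  exact congrArg _ (funext fun i => Measure.map_congr (hF i))

/-- Draws at distinct positions are independent and uniform, which is checked on boxes. -/
theorem map_comp_randomSupply {ι : Type*} [Fintype ι] {e : ι → ℕ} (he : Function.Injective e) :
    MeasurePreserving (fun (ω : ℕ → unitInterval) i => ω (e i)) randomSupply
      (Measure.pi fun _ => volume) := by
  classical
  have hm : Measurable fun (ω : ℕ → unitInterval) i => ω (e i) :=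
    measurable_pi_lambda _ fun i => measurable_pi_apply _
  refine ⟨hm, (Measure.pi_eq fun s hs => ?_).symm⟩
  rw [Measure.map_apply hm (MeasurableSet.univ_pi hs)]
  have hpre : (fun (ω : ℕ → unitInterval) i => ω (e i)) ⁻¹' Set.univ.pi s =
      Set.pi (Finset.univ.image e : Finset ℕ) (Function.extend e s fun _ => Set.univ) := by
    ext ω
    simp [he.extend_apply]
  rw [hpre, randomSupply, Measure.infinitePi_pi _ (by simp [he.extend_apply, hs]),
    Finset.prod_image fun i _ j _ h => he h]
  simp [he.extend_apply]

open scoped Classical in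
/-- The increasing rearrangement of the coordinates (of a point of the cube with distinct
coordinates). -/
def orderStat {d : ℕ} (v : Fin d → ℝ) : Fin d → ℝ :=
  ∑ σ : Equiv.Perm (Fin d), (permCell σ).indicator (fun z => z ∘ σ.symm) v

theorem measurable_orderStat (d : ℕ) : Measurable (orderStat (d := d)) :=
  Finset.measurable_fun_sum _ fun σ _ =>
    (measurePreserving_comp_perm σ.symm).measurable.indicator (measurableSet_permCell σ)

theorem orderStat_of_mem {d : ℕ} {σ : Equiv.Perm (Fin d)} {v : Fin d → ℝ} (hv : v ∈ permCell σ) :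
    orderStat v = v ∘ σ.symm := by
  classical
  rw [orderStat, Finset.sum_eq_single σ, Set.indicator_of_mem hv]
  · intro τ _ hτ
    exact Set.indicator_of_notMem (fun h => Set.disjoint_left.1 (permCell_disjoint hτ) h hv) _
  · simp

/-- Sorting maps each of the `d!` cells to the simplex by a coordinate permutation. The image
measure is `d!` times Lebesgue measure there, which is the normalized one. -/
theorem measurePreserving_orderStat (d : ℕ) :
    MeasurePreserving orderStat ((volume : Measure (Fin d → ℝ)).restrict (openCube d))
      (ProbabilityTheory.cond volume (fundamentalSimplex d)) := by
  refine ⟨measurable_orderStat d, ?_⟩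
  have h := (map_eq_sum_restrict (μ := (volume : Measure (Fin d → ℝ)).restrict (openCube d))
    (A := permCell) (F := orderStat) (G := fun σ z => z ∘ σ.symm) measurableSet_permCell
    (fun σ τ => permCell_disjoint) ?_
    (fun σ => (measurePreserving_comp_perm σ.symm).measurable) fun σ => ?_).2
  · rw [h]
    have hr : ∀ σ : Equiv.Perm (Fin d), (((volume : Measure (Fin d → ℝ)).restrict
        (openCube d)).restrict (permCell σ)).map (fun z => z ∘ σ.symm) =
        volume.restrict (fundamentalSimplex d) := by
      intro σ
      rw [Measure.restrict_restrict (measurableSet_permCell σ),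
        Set.inter_eq_left.2 (permCell_subset σ)]
      exact ((measurePreserving_comp_perm σ.symm).restrict_preimage
        (measurableSet_fundamentalSimplex d)).map_eq
    simp only [hr]
    ext E hE
    rw [Measure.sum_apply _ hE, tsum_fintype, ProbabilityTheory.cond, volume_fundamentalSimplex,
      inv_inv, Measure.smul_apply, Finset.sum_const, Finset.card_univ, Fintype.card_perm,
      Fintype.card_fin, nsmul_eq_mul, smul_eq_mul]
  · filter_upwards [ae_restrict_mem (measurableSet_openCube d), ae_restrict_of_ae (ae_injective d)]
      with x hx hinj
    exact Set.mem_iUnion.2 (exists_mem_permCell hx hinj)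
  · filter_upwards [ae_restrict_mem (measurableSet_permCell σ)] with x hx
    exact orderStat_of_mem hx

theorem measurePreserving_coe_openCube (d : ℕ) :
    MeasurePreserving (fun (u : Fin d → unitInterval) i => (u i : ℝ)) (Measure.pi fun _ => volume)
      ((volume : Measure (Fin d → ℝ)).restrict (openCube d)) := by
  rw [restrict_openCube, Measure.restrict_congr_set Ioc_ae_eq_Icc]
  exact measurePreserving_pi _ _ fun _ => unitInterval.measurePreserving_coe

theorem measurable_signOf : Measurable signOf :=
  Measurable.ite (measurableSet_lt (measurable_id.add measurable_id) measurable_const)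
    measurable_const measurable_const

theorem volume_signOf_eq_neg_one :
    (volume : Measure unitInterval) {u | signOf u = -1} = 2⁻¹ := by
  have h : {u : unitInterval | signOf u = -1} = Subtype.val ⁻¹' Set.Iio (1 / 2 : ℝ) := by
    ext u
    simp only [signOf, Set.mem_ofPred_eq, Set.mem_preimage, Set.mem_Iio]
    split_ifs with h
    · exact iff_of_true (by norm_num) (by linarith)
    · exact iff_of_false (by norm_num) (by linarith)
  rw [h, unitInterval.measurePreserving_coe.measure_preimage measurableSet_Iio.nullMeasurableSet,
    Measure.restrict_apply measurableSet_Iio]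
  have : Set.Iio (1 / 2 : ℝ) ∩ unitInterval = Set.Ico 0 (1 / 2) := by
    ext x
    simp only [Set.mem_inter_iff, Set.mem_Iio, Set.mem_Icc, Set.mem_Ico]
    constructor
    · rintro ⟨h1, h2, -⟩; exact ⟨h2, h1⟩
    · rintro ⟨h1, h2⟩; exact ⟨h2, h1, by linarith⟩
  rw [this, Real.volume_Ico]
  simp

theorem volume_signOf_mem (E : Set ℝ) [Decidable ((-1 : ℝ) ∈ E)] [Decidable ((1 : ℝ) ∈ E)] :
    (volume : Measure unitInterval) {u | signOf u ∈ E} =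
      2⁻¹ * ((if (-1 : ℝ) ∈ E then 1 else 0) + if (1 : ℝ) ∈ E then 1 else 0) := by
  have hs : ∀ u, signOf u = -1 ∨ signOf u = 1 := by
    intro u
    unfold signOf
    split_ifs
    · left; norm_num
    · right; rfl
  have hc : (volume : Measure unitInterval) {u | signOf u = -1}ᶜ = 2⁻¹ := by
    have hm : MeasurableSet {u : unitInterval | signOf u = -1} :=
      measurable_signOf.comp measurable_subtype_coe (measurableSet_singleton (-1))
    rw [prob_compl_eq_one_sub hm, volume_signOf_eq_neg_one, ENNReal.one_sub_inv_two]
  split_ifs with h1 h2 h2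
  · rw [show {u : unitInterval | signOf u ∈ E} = Set.univ from Set.eq_univ_of_forall fun u => by
      rcases hs u with h | h <;> simp [h, h1, h2], measure_univ, one_add_one_eq_two,
      ENNReal.inv_mul_cancel (by simp) (by simp)]
  · rw [add_zero, mul_one, ← volume_signOf_eq_neg_one]
    congr 1
    ext u
    rcases hs u with h | h
    · simp [h, h1]
    · simp only [Set.mem_ofPred_eq, h, h2, false_iff]; norm_num
  · rw [zero_add, mul_one, ← hc]
    congr 1
    ext u
    rcases hs u with h | h
    · simp [h, h1]
    · simp only [Set.mem_ofPred_eq, Set.mem_compl_iff, h, h2, true_iff]; norm_num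
  · rw [show {u : unitInterval | signOf u ∈ E} = ∅ from Set.eq_empty_of_forall_notMem fun u => by
      rcases hs u with h | h <;> simp [h, h1, h2]]
    simp

theorem card_signFinset (d : ℕ) : (signFinset d).card = 2 ^ d := by
  classical
  rw [signFinset, Fintype.card_piFinset]
  simp [Finset.card_pair (show (-1 : ℝ) ≠ 1 by norm_num)]

theorem measurePreserving_signOf (d : ℕ) :
    MeasurePreserving (fun (u : Fin d → unitInterval) i => signOf (u i))
      (Measure.pi fun _ => volume) (uniformOn (signVectors d)) := by
  classical
  have hm : Measurable fun u : unitInterval => signOf u :=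
    measurable_signOf.comp measurable_subtype_coe
  have hprob := Measure.isProbabilityMeasure_map (μ := (volume : Measure unitInterval)) hm.aemeasurable
  have h1 := measurePreserving_pi (fun _ : Fin d => (volume : Measure unitInterval))
    (fun _ => (volume : Measure unitInterval).map fun u : unitInterval => signOf u)
    fun _ => ⟨hm, rfl⟩
  convert h1 using 1
  refine (Measure.pi_eq fun t ht => ?_).symm
  rw [← lintegral_indicator_one (MeasurableSet.univ_pi ht), ← coe_signFinset, lintegral_uniformOn,
    card_signFinset]
  have hind : ∀ s : Fin d → ℝ, (Set.univ.pi t).indicator (1 : (Fin d → ℝ) → ℝ≥0∞) s =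
      ∏ i, if s i ∈ t i then 1 else 0 := by
    intro s
    rw [Finset.prod_ite_zero]
    simp [Set.indicator_apply]
  rw [Finset.sum_congr rfl fun s _ => hind s, signFinset,
    -- Distributivity turns the sum over sign vectors into a product of sums over two signs, so the
    -- comparison is made in each coordinate.
    ← Finset.prod_univ_sum (fun _ => {-1, 1}) (fun i a => if a ∈ t i then (1 : ℝ≥0∞) else 0)]
  have hv : ∀ i, ((volume : Measure unitInterval).map fun u : unitInterval => signOf u) (t i) =
      2⁻¹ * ∑ a ∈ ({-1, 1} : Finset ℝ), if a ∈ t i then (1 : ℝ≥0∞) else 0 := by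
    intro i
    rw [Measure.map_apply hm (ht i), Finset.sum_pair (by norm_num)]
    exact volume_signOf_mem (t i)
  rw [Finset.prod_congr rfl fun i _ => hv i, Finset.prod_mul_distrib]
  simp [ENNReal.inv_pow]

/-! ### The law of the sampler -/

/-- The point of the simplex and the signs that the sampler produces. -/
def pointSigns (d : ℕ) (ω : ℕ → unitInterval) : (Fin d → ℝ) × (Fin d → ℝ) :=
  (orderStat fun i : Fin d => (ω (2 * d + 1 + i) : ℝ), fun i => signOf (ω (3 * d + 1 + i)))

/-- The three blocks of positions are disjoint, so the draws behind the permutation, the simplex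
point and the signs are jointly independent. -/
theorem measurePreserving_pointSigns (d : ℕ) :
    MeasurePreserving (fun ω => ((fun i : Fin (2 * d + 1) => ω i), pointSigns d ω)) randomSupply
      ((Measure.pi fun _ => volume).prod (pointSignLaw d)) := by
  have he : Function.Injective (Sum.elim (fun i : Fin (2 * d + 1) => (i : ℕ))
      (Sum.elim (fun i : Fin d => 2 * d + 1 + (i : ℕ)) fun i : Fin d => 3 * d + 1 + (i : ℕ))) := by
    rintro (i | i | i) (j | j | j) h <;> simp only [Sum.elim_inl, Sum.elim_inr] at h
    all_goals first
      | omega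
      | (have hij : i = j := by ext; omega
         rw [hij])
  have h0 := map_comp_randomSupply he
  have h1 := measurePreserving_sumPiEquivProdPi
    (X := fun _ : Fin (2 * d + 1) ⊕ (Fin d ⊕ Fin d) => unitInterval) fun _ => volume
  have h2 := (MeasurePreserving.id (Measure.pi fun _ : Fin (2 * d + 1) =>
    (volume : Measure unitInterval))).prod (measurePreserving_sumPiEquivProdPi
      (X := fun _ : Fin d ⊕ Fin d => unitInterval) fun _ => volume)
  have h3 := (MeasurePreserving.id (Measure.pi fun _ : Fin (2 * d + 1) =>
    (volume : Measure unitInterval))).prod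
      (((measurePreserving_orderStat d).comp (measurePreserving_coe_openCube d)).prod
        (measurePreserving_signOf d))
  exact h3.comp (h2.comp (h1.comp h0))

theorem rank_of_mem_permCell {d : ℕ} {v : ℕ → ℝ} {τ : Equiv.Perm (Fin d)}
    (hv : (fun i : Fin d => v i) ∈ permCell τ) (i : Fin d) : rank d v i = τ i := by
  classical
  have h : ∀ l : Fin d, v l < v i ↔ τ l < τ i := by
    intro l
    have := (hv.2 : StrictMono ((fun i : Fin d => v i) ∘ τ.symm)).lt_iff_lt (a := τ l) (b := τ i)
    simpa using this
  rw [rank, Finset.sum_range]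
  simp only [h]
  rw [Equiv.sum_comp τ fun l => if l < τ i then 1 else 0, ← Finset.card_filter]
  have : (Finset.univ.filter fun l => l < τ i) = Finset.Iio (τ i) := by
    ext; simp
  rw [this, Fin.card_Iio]

theorem transcript_eq_mkTranscript {d : ℕ} {ω : ℕ → unitInterval} {m : Memory}
    {σ τ : Equiv.Perm (Fin d)} (hτ : (fun i : Fin d => (ω (2 * d + 1 + i) : ℝ)) ∈ permCell τ)
    (hlevel : m.int 1 0 = ascents σ + 1) (hword : ∀ i < d, m.int 2 i = permWord σ i)
    (hpoint : Set.InjOn (rank d fun l => ω (2 * d + 1 + l)) (Set.Iio d) → ∀ i < d,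
      m.real 1 (rank d (fun l => ω (2 * d + 1 + l)) i) = ω (2 * d + 1 + i))
    (hsign : ∀ i < d, m.real 2 i = signOf (ω (3 * d + 1 + i)))
    (hout : ∀ i : Fin d, m.real 0 i = m.real 2 i *
      stanley (fun l : Fin d => m.real 1 (m.int 2 l)) i) :
    m.transcript d = mkTranscript (ascents σ + 1) (σ, pointSigns d ω) := by
  have hrank := rank_of_mem_permCell (v := fun l => (ω (2 * d + 1 + l) : ℝ)) hτ
  have hinj : Set.InjOn (rank d fun l => ω (2 * d + 1 + l)) (Set.Iio d) := by
    intro i hi j hj h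
    have hij := (hrank ⟨i, hi⟩).symm.trans (h.trans (hrank ⟨j, hj⟩))
    exact congrArg Fin.val (τ.injective (Fin.ext hij))
  have hx : ∀ i : Fin d, m.real 1 i = (pointSigns d ω).1 i := by
    intro i
    have h := hpoint hinj (τ.symm i) (τ.symm i).isLt
    rw [hrank, τ.apply_symm_apply] at h
    rw [h, pointSigns, orderStat_of_mem hτ]
    rfl
  have hw : ∀ i : Fin d, m.int 2 i = σ i := fun i => (hword i i.isLt).trans (permWord_val σ i)
  have hs : ∀ i : Fin d, m.real 2 i = (pointSigns d ω).2 i := fun i => hsign i i.isLt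
  have hy : m.output d = fun i => (pointSigns d ω).2 i *
      stanley (fun l => (pointSigns d ω).1 (σ l)) i := by
    funext i
    rw [Memory.output, hout i, hs i]
    simp only [hw, hx]
  simp only [Memory.transcript, mkTranscript, hx, hs, hy, hw, hlevel]

/-- No measurability of `final` is assumed. On the box of `σ` the transcript agrees almost
everywhere with a measurable function, and gluing these pieces yields both almost-everywhere
measurability and the law. -/
theorem map_transcript {d k : ℕ} (hd : 1 ≤ d) (hk : 1 ≤ k) {final : (ℕ → unitInterval) → Memory}
    (hlevel : ∀ ω, (final ω).int 1 0 = level d k (fun l => ω l) 0)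
    (hword : ∀ ω, ∀ i < d, (final ω).int 2 i = word d k (fun l => ω l) d i)
    (hpoint : ∀ ω : ℕ → unitInterval, Set.InjOn (rank d fun l => ω (2 * d + 1 + l)) (Set.Iio d) →
      ∀ i < d, (final ω).real 1 (rank d (fun l => ω (2 * d + 1 + l)) i) = ω (2 * d + 1 + i))
    (hsign : ∀ ω : ℕ → unitInterval, ∀ i < d, (final ω).real 2 i = signOf (ω (3 * d + 1 + i)))
    (hout : ∀ ω, ∀ i : Fin d, (final ω).real 0 i = (final ω).real 2 i *
      stanley (fun l : Fin d => (final ω).real 1 ((final ω).int 2 l)) i) :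
    AEMeasurable (fun ω => (final ω).transcript d) randomSupply ∧
      randomSupply.map (fun ω => (final ω).transcript d) = transcriptLaw d k := by
  classical
  choose A hA hvol hbox using fun σ : {σ : Equiv.Perm (Fin d) // ascents σ < k} =>
    exists_box hd σ.1 σ.2
  have hmp := measurePreserving_pointSigns d
  have hN : ENNReal.ofReal (1 / lowCount d k) = (lowCount d k : ℝ≥0∞)⁻¹ := by
    rw [one_div, ENNReal.ofReal_inv_of_pos (by exact_mod_cast lowCount_pos hd hk),
      ENNReal.ofReal_natCast]
  have hcard : Fintype.card {σ : Equiv.Perm (Fin d) // ascents σ < k} = lowCount d k := by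
    rw [← Nat.card_eq_fintype_card]
    rfl
  let B (σ : {σ : Equiv.Perm (Fin d) // ascents σ < k}) : Set (ℕ → unitInterval) :=
    {ω | ∀ i < 2 * d + 1, ω i ∈ A σ i}
  have hpre (σ) (E : Set ((Fin d → ℝ) × (Fin d → ℝ))) : B σ ∩ pointSigns d ⁻¹' E =
      (fun ω => ((fun i : Fin (2 * d + 1) => ω i), pointSigns d ω)) ⁻¹'
        ((Set.univ.pi fun i : Fin (2 * d + 1) => A σ i) ×ˢ E) := by
    ext ω
    simp only [B, Set.mem_inter_iff, Set.mem_preimage, Set.mem_prod, Set.mem_univ_pi,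
      Set.mem_ofPred_eq]
    exact and_congr_left fun _ => ⟨fun h i => h i i.isLt, fun h i hi => h ⟨i, hi⟩⟩
  have hBE (σ) {E : Set ((Fin d → ℝ) × (Fin d → ℝ))} (hE : MeasurableSet E) :
      randomSupply (B σ ∩ pointSigns d ⁻¹' E) = (lowCount d k : ℝ≥0∞)⁻¹ * pointSignLaw d E := by
    rw [hpre, hmp.measure_preimage
      ((MeasurableSet.univ_pi fun i : Fin (2 * d + 1) => hA σ i).prod hE).nullMeasurableSet, Measure.prod_prod,
      Measure.pi_pi, ← hN, ← hvol σ, Finset.prod_range]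
  have hBm (σ) : MeasurableSet (B σ) := by
    have := hmp.measurable
      ((MeasurableSet.univ_pi fun i : Fin (2 * d + 1) => hA σ i).prod MeasurableSet.univ)
    rwa [← hpre, Set.preimage_univ, Set.inter_univ] at this
  -- A draw sequence in two boxes would force two different words.
  have hdisj : Pairwise (Function.onFun Disjoint B) := by
    intro σ τ hne
    refine Set.disjoint_left.2 fun ω hσ hτ => hne (Subtype.ext (Equiv.ext fun i => Fin.ext ?_))
    rw [← permWord_val, ← permWord_val, ← (hbox σ ω hσ).2 i i.isLt, (hbox τ ω hτ).2 i i.isLt]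
  -- There are `lowCount d k` disjoint boxes of mass `1 / lowCount d k`, so almost nothing is left
  -- outside.
  have hcover : ∀ᵐ ω ∂randomSupply, ω ∈ ⋃ σ, B σ := by
    have hp : IsProbabilityMeasure randomSupply := by unfold randomSupply; infer_instance
    refine (mem_ae_iff_prob_eq_one (MeasurableSet.iUnion hBm)).2 ?_
    have h1 (σ) : randomSupply (B σ) = (lowCount d k : ℝ≥0∞)⁻¹ := by
      have := hBE σ MeasurableSet.univ
      rwa [Set.preimage_univ, Set.inter_univ, measure_univ, mul_one] at this
    rw [measure_iUnion hdisj hBm, tsum_fintype, Finset.sum_congr rfl fun σ _ => h1 σ,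
      Finset.sum_const, Finset.card_univ, hcard, nsmul_eq_mul,
      ENNReal.mul_inv_cancel (by exact_mod_cast (lowCount_pos hd hk).ne') (by simp)]
  -- Ties and boundary values among the simplex draws have probability zero; outside them the rank
  -- sort is correct.
  have hcell : ∀ᵐ ω ∂randomSupply, ∃ τ : Equiv.Perm (Fin d),
      (fun i : Fin d => (ω (2 * d + 1 + i) : ℝ)) ∈ permCell τ := by
    have hm := (measurePreserving_coe_openCube d).comp (map_comp_randomSupply
      (e := fun i : Fin d => 2 * d + 1 + (i : ℕ)) fun i j h => Fin.ext (Nat.add_left_cancel h))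
    refine hm.quasiMeasurePreserving.ae (p := fun v => ∃ τ : Equiv.Perm (Fin d), v ∈ permCell τ) ?_
    filter_upwards [ae_restrict_mem (measurableSet_openCube d), ae_restrict_of_ae (ae_injective d)]
      with x hx hinj
    exact exists_mem_permCell hx hinj
  have hG (σ : {σ : Equiv.Perm (Fin d) // ascents σ < k}) :
      Measurable fun ω => mkTranscript (ascents σ.1 + 1) (σ.1, pointSigns d ω) :=
    (measurable_mkTranscript_pair _ σ.1).comp (measurable_snd.comp hmp.measurable)
  obtain ⟨h1, h2⟩ := map_eq_sum_restrict (F := fun ω => (final ω).transcript d) hBm hdisj hcover hG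
    fun σ => by
      filter_upwards [ae_restrict_mem (hBm σ), ae_restrict_of_ae hcell] with ω hω hτ
      obtain ⟨τ, hτ⟩ := hτ
      have hb := hbox σ ω hω
      exact transcript_eq_mkTranscript hτ ((hlevel ω).trans hb.1)
        (fun i hi => (hword ω i hi).trans (hb.2 i hi)) (hpoint ω) (hsign ω) (hout ω)
  refine ⟨h1, h2.trans (Measure.ext fun E hE => ?_)⟩
  rw [Measure.sum_apply _ hE, tsum_fintype, transcriptLaw_apply hd k hE, Finset.mul_sum]
  have h3 (σ : {σ : Equiv.Perm (Fin d) // ascents σ < k}) :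
      (randomSupply.restrict (B σ)).map
        (fun ω => mkTranscript (ascents σ.1 + 1) (σ.1, pointSigns d ω)) E =
      (lowCount d k : ℝ≥0∞)⁻¹ *
        pointSignLaw d {q | mkTranscript (ascents σ.1 + 1) (σ.1, q) ∈ E} := by
    rw [Measure.map_apply (hG σ) hE, Measure.restrict_apply (hG σ hE), Set.inter_comm]
    exact hBE σ (measurable_mkTranscript_pair _ σ.1 hE)
  rw [Finset.sum_congr rfl fun σ _ => h3 σ]
  simp only [mul_ite, mul_zero]
  rw [← Finset.sum_filter, ← Finset.sum_subtype_eq_sum_filter]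
  exact Finset.sum_congr (by ext; simp) fun σ _ => rfl

end SumBall

end

/-! ### The main theorem. -/

theorem mainTheorem1 :
    -- the volumes of the slices are given by the Eulerian numbers
    (∀ d j : ℕ, 1 ≤ d → 1 ≤ j →
      volume (slice d j) = (eulerian d (j - 1) : ℝ≥0∞) / (d ! : ℝ≥0∞)) ∧
    -- one program samples the Sum ball for all `d` and `k`
    ∃ (P : Program) (C : ℕ), ∀ d k : ℕ, 1 ≤ d → 1 ≤ k →
      ∃ final : (ℕ → unitInterval) → Memory,
        -- it always halts within `C * d ^ 2` steps
        (∀ ω, ∃ t ≤ C * d ^ 2, Runs ω P (Memory.init d k) t (final ω)) ∧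
        -- it proceeds by slice, permutation, simplex, Stanley's map and signs
        randomSupply.map (fun ω => (final ω).transcript d) = transcriptLaw d k ∧
        -- its output is uniform on the Sum ball
        randomSupply.map (fun ω => (final ω).output d) = cond volume (sumBall d k) := by
  refine ⟨fun d j hd hj => volume_slice hd hj, sampler, 10000, fun d k hd hk => ?_⟩
  choose t ht final hruns hlevel hword hpoint hsign hout using fun ω => reaches_sampler ω hd hk
  obtain ⟨hm, hlaw⟩ := map_transcript hd hk hlevel hword hpoint hsign hout
  refine ⟨final, fun ω => ⟨t ω, ht ω, hruns ω⟩, hlaw, ?_⟩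
  have hmeas : Measurable fun t : Transcript d => t.2.2.2.2 :=
    measurable_snd.comp (measurable_snd.comp (measurable_snd.comp measurable_snd))
  -- The output is a projection of the transcript. Composing the image measures needs the
  -- almost-everywhere measurability `hm`, as `final` was obtained by choice.
  rw [← map_output_transcriptLaw hd hk, ← hlaw, AEMeasurable.map_map_of_aemeasurable
    hmeas.aemeasurable hm]
  rfl
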